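/- **Setting.** Let $\phi:\mathbb R\to[0,+\infty]$ be a closed convex function with $\phi(1)=0$, whose domain is an interval with endpoints $a_\phi<1<b_\phi$ (possibly infinite), which is strictly convex and essentially smooth on $]a_\phi,b_\phi[$ (differentiable there, with $\phi'\to-\infty$ at $a_\phi$ if $a_\phi>-\infty$ and $\phi'\to+\infty$ at $b_\phi$ if $b_\phi<\infty$), has continuous derivatives up to order $4$ on $]a_\phi,b_\phi[$, and satisfies $\phi''(1)>0$. Let $\{P_\theta;\theta\in\Theta\}$, $\Theta\subset\mathbb R^d$ (not necessarily open), be an identifiable model with densities $p_\theta$ with respect to a $\sigma$-finite measure $\lambda$ and with common support (for $\lambda$-a.e. $x$, either $p_\theta(x)>0$ for all $\theta\in\Theta$ or $p_\theta(x)=0$ for all $\theta\in\Theta$). Put $$f(\theta,\alpha,x)=\phi'\!\Big(\frac{p_\theta(x)}{p_\alpha(x)}\Big),\quad g(\theta,\alpha,x)=\frac{p_\theta(x)}{p_\alpha(x)}\,\phi'\!\Big(\frac{p_\theta(x)}{p_\alpha(x)}\Big)-\phi\Big(\frac{p_\theta(x)}{p_\alpha(x)}\Big),\quad h(\theta,\alpha,x)=\int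 f(\theta,\alpha)\,dP_\theta-g(\theta,\alpha,x),$$ and assume that these are well defined (for $\lambda$-a.e. $x$ in the support, $p_\theta(x)/p_\alpha(x)\in\,]a_\phi,b_\phi[$ for all $\theta,\alpha\in\Theta$) and that $\int|f(\theta,\alpha)|\,dP_\theta<\infty$ for all $\theta,\alpha\in\Theta$. Let $X_1,X_2,\dots$ be i.i.d. with law $P_{\theta_T}$, where $\theta_T$ is an interior point of $\Theta$, and let $P_n$ be the empirical measure of $X_1,\dots,X_n$. **Null hypothesis.** Let $0\le l\le d$ and $\Theta_0\subset\Theta$ with $\Theta_0=s(B_0)$, where $B_0\subset\mathbb R^{d-l}$ is open and $s:B_0\to\mathbb R^d$ is $C^1$ with derivative of rank $d-l$, and assume that there is $r:\Theta\to\mathbb R^l$, of class $C^1$ with derivative of rank $l$ on the interior of $\Theta$, such that $r=0$ on $\Theta_0$. Assume $\mathcal H_0:\theta_T\in\Theta_0$. **Conditions.** There is an open neighbourhood $N\subset\Theta$ of $\theta_T$ such that: 1. for $\lambda$-a.e. $x$, $\theta\mapsto p_\theta(x)$ is $C^3$ on $N$; 2. the first and second order partial derivatives with respect to $(\theta,\alpha)$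 of $f(\theta,\alpha,x)p_\theta(x)$ are dominated on $N\times N$ by a $\lambda$-integrable function of $x$; for $P_{\theta_T}$-a.e. $x$, $(\theta,\alpha)\mapsto h(\theta,\alpha,x)$ is $C^3$ on $N\times N$, and its third order partial derivatives are dominated there by a $P_{\theta_T}$-integrable function of $x$; 3. the first order partial derivatives of $h$ at $(\theta_T,\theta_T)$ are in $L^2(P_{\theta_T})$, those of second order (pure and mixed) are in $L^1(P_{\theta_T})$, and the Fisher information matrix $I_{\theta_T}=\int p'_{\theta_T}{p'_{\theta_T}}^{T}/p_{\theta_T}\,d\lambda$ is nonsingular; 4. the estimators exist and are consistent: there are $\widehat\theta_n$, a neighbourhood $U$ of $\theta_T$ and $\widehat\alpha_n(\theta)$, $\theta\in\Theta_0\cap U$, such that, with probability tending to $1$, $\widehat\theta_n$ minimizes $\theta\mapsto\sup_{\alpha\in\Theta}P_nh(\theta,\alpha)$ over $\Theta_0$ and, for all $\theta\in\Theta_0\cap U$, $\widehat\alpha_n(\theta)$ maximizes $\alpha\mapsto P_nh(\theta,\alpha)$ over $\Theta$; moreover $\widehat\theta_n\to\theta_T$ and $\sup_{\theta\in\Theta_0\cap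 U}\|\widehat\alpha_n(\theta)-\theta_T\|\to0$ in probability. **Theorem.** Under these conditions the statistic $$T_n=\frac{2n}{\phi''(1)}\,\inf_{\theta\in\Theta_0}\sup_{\alpha\in\Theta}P_nh(\theta,\alpha)$$ (assumed measurable) converges in distribution to a $\chi^2$ random variable with $l$ degrees of freedom, i.e. to the sum of the squares of $l$ independent standard normal variables. (On the event, of probability tending to $0$, where the infimum is infinite, $T_n$ is given the value $0$.) Moreover, if $\phi(x)=-\log x+x-1$ for $x>0$ and $\phi(x)=+\infty$ for $x\le0$, then for every $n$, almost surely, $T_n$ is the generalized likelihood ratio statistic $$2\log\frac{\sup_{\alpha\in\Theta}\prod_{i=1}^np_\alpha(X_i)}{\sup_{\theta\in\Theta_0}\prod_{i=1}^np_\theta(X_i)}$$ (given the value $0$ when it is not finite). -/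

import Mathlib

open MeasureTheory ProbabilityTheory Filter Topology
open scoped ENNReal

noncomputable section

/-! ### Divergence functions -/

/-- The effective domain of a convex function `φ : ℝ → [0, +∞]`. -/
def phiDom (φ : ℝ → ℝ≥0∞) : Set ℝ := {x | φ x ≠ ∞}

/-- The finite part of `φ`; it is only meaningful on `phiDom φ`. -/
def phiReal (φ : ℝ → ℝ≥0∞) (x : ℝ) : ℝ := (φ x).toReal

/-- The derivative `φ'`; it is only meaningful on the interior of `phiDom φ`. -/
def phiDeriv (φ : ℝ → ℝ≥0∞) (x : ℝ) : ℝ := deriv (phiReal φ) x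

/-- The second derivative `φ''`. -/
def phiDeriv2 (φ : ℝ → ℝ≥0∞) (x : ℝ) : ℝ := deriv (phiDeriv φ) x

/-- `φ : ℝ → [0, +∞]` is a closed convex function with `φ 1 = 0`, whose domain is an interval
with endpoints `a < 1 < b` (possibly infinite), and which is strictly convex and essentially
smooth: differentiable inside its domain, with derivative tending to `-∞` (resp. `+∞`) at the left
(resp. right) endpoint of the domain if that endpoint is finite. -/
structure IsDivergenceFunction (φ : ℝ → ℝ≥0∞) : Prop where
  convex : ∀ x y a b : ℝ, 0 ≤ a → 0 ≤ b → a + b = 1 →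
    φ (a * x + b * y) ≤ ENNReal.ofReal a * φ x + ENNReal.ofReal b * φ y
  closed : LowerSemicontinuous φ
  map_one : φ 1 = 0
  one_mem : (1 : ℝ) ∈ interior (phiDom φ)
  strictConvex : StrictConvexOn ℝ (interior (phiDom φ)) (phiReal φ)
  differentiable : DifferentiableOn ℝ (phiReal φ) (interior (phiDom φ))
  steep_left : ∀ a : ℝ, IsGLB (phiDom φ) a → Tendsto (phiDeriv φ) (𝓝[>] a) atBot
  steep_right : ∀ b : ℝ, IsLUB (phiDom φ) b → Tendsto (phiDeriv φ) (𝓝[<] b) atTop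

/-- The function `φ₀(x) = -log x + x - 1` on `(0, ∞)`, `+∞` on `(-∞, 0]`, of the modified
Kullback-Leibler divergence. -/
def phiKLm (x : ℝ) : ℝ≥0∞ := if 0 < x then ENNReal.ofReal (-Real.log x + x - 1) else ∞

/-! ### Parametric models -/

/-- An identifiable parametric model, indexed by an arbitrary subset `Θ` of `ℝ^d`, dominated by a
`σ`-finite measure, whose densities all have the same support. -/
structure ParametricModel (d : ℕ) (𝒳 : Type*) [MeasurableSpace 𝒳] where
  /-- the parameter space -/
  Θ : Set (EuclideanSpace ℝ (Fin d))
  /-- the dominating measure -/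
  ref : Measure 𝒳
  sigmaFinite : SigmaFinite ref
  /-- the density of the distribution with parameter `θ` -/
  p : EuclideanSpace ℝ (Fin d) → 𝒳 → ℝ
  measurable_p : ∀ θ ∈ Θ, Measurable (p θ)
  p_nonneg : ∀ θ ∈ Θ, ∀ x, 0 ≤ p θ x
  lintegral_p : ∀ θ ∈ Θ, ∫⁻ x, ENNReal.ofReal (p θ x) ∂ref = 1
  identifiable : Set.InjOn (fun θ => ref.withDensity fun x => ENNReal.ofReal (p θ x)) Θ
  common_support : ∀ᵐ x ∂ref, ∀ θ ∈ Θ, ∀ α ∈ Θ, (0 < p θ x ↔ 0 < p α x)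

namespace ParametricModel

variable {d : ℕ} {𝒳 : Type*} [MeasurableSpace 𝒳] (M : ParametricModel d 𝒳) (φ : ℝ → ℝ≥0∞)

/-- The distribution `P_θ` with density `p θ`. -/
def P (θ : EuclideanSpace ℝ (Fin d)) : Measure 𝒳 :=
  M.ref.withDensity fun x => ENNReal.ofReal (M.p θ x)

/-- `f(θ, α, x) = φ'(p_θ(x) / p_α(x))`. -/
def f (θ α : EuclideanSpace ℝ (Fin d)) (x : 𝒳) : ℝ := phiDeriv φ (M.p θ x / M.p α x)

/-- `g(θ, α, x) = (p_θ(x) / p_α(x)) φ'(p_θ(x) / p_α(x)) - φ(p_θ(x) / p_α(x))`. -/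
def g (θ α : EuclideanSpace ℝ (Fin d)) (x : 𝒳) : ℝ :=
  M.p θ x / M.p α x * phiDeriv φ (M.p θ x / M.p α x) - phiReal φ (M.p θ x / M.p α x)

/-- `h(θ, α, x) = P_θ f(θ, α) - g(θ, α, x)`. -/
def h (θ α : EuclideanSpace ℝ (Fin d)) (x : 𝒳) : ℝ :=
  (∫ y, M.f φ θ α y ∂(M.P θ)) - M.g φ θ α x

/-- The functions `f(θ, α)` and `g(θ, α)` are well defined (the density ratio lies in the open
interval where `φ` is differentiable) and `f(θ, α)` is `P_θ`-integrable, for all `θ, α ∈ Θ`. -/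
structure IntegrabilityCondition : Prop where
  ratio_mem : ∀ᵐ x ∂M.ref, ∀ θ ∈ M.Θ, ∀ α ∈ M.Θ, 0 < M.p α x →
    M.p θ x / M.p α x ∈ interior (phiDom φ)
  integrable : ∀ θ ∈ M.Θ, ∀ α ∈ M.Θ, Integrable (M.f φ θ α) (M.P θ)

/-- The Fisher information matrix at `θ`, the integral of `p'_θ p'_θᵀ / p_θ`. -/
def fisherInfo (θ : EuclideanSpace ℝ (Fin d)) : Matrix (Fin d) (Fin d) ℝ :=
  Matrix.of fun i j => ∫ x,
    fderiv ℝ (fun t => M.p t x) θ (EuclideanSpace.single i 1) *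
      fderiv ℝ (fun t => M.p t x) θ (EuclideanSpace.single j 1) / M.p θ x ∂M.ref

/-- Domination on `N × N`: all first and second order partial derivatives in `(θ, α)` of
`f(θ, α, x) p_θ(x)` are dominated by an integrable function for the dominating measure, and those of
order three of `h(θ, α, x)` exist and are dominated by a `P_{θT}`-integrable function. -/
structure DominationCondition (θT : EuclideanSpace ℝ (Fin d))
    (N : Set (EuclideanSpace ℝ (Fin d))) : Prop where
  dom_fp : ∃ G : 𝒳 → ℝ, Integrable G M.ref ∧ ∀ᵐ x ∂M.ref, ∀ z ∈ N ×ˢ N,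
    ‖iteratedFDeriv ℝ 1 (fun z : EuclideanSpace ℝ (Fin d) × EuclideanSpace ℝ (Fin d) =>
      M.f φ z.1 z.2 x * M.p z.1 x) z‖ ≤ G x ∧
    ‖iteratedFDeriv ℝ 2 (fun z : EuclideanSpace ℝ (Fin d) × EuclideanSpace ℝ (Fin d) =>
      M.f φ z.1 z.2 x * M.p z.1 x) z‖ ≤ G x
  dom_h : ∃ H : 𝒳 → ℝ, Integrable H (M.P θT) ∧ ∀ᵐ x ∂(M.P θT),
    ContDiffOn ℝ 3 (fun z : EuclideanSpace ℝ (Fin d) × EuclideanSpace ℝ (Fin d) =>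
      M.h φ z.1 z.2 x) (N ×ˢ N) ∧
    ∀ z ∈ N ×ˢ N,
      ‖iteratedFDeriv ℝ 3 (fun z : EuclideanSpace ℝ (Fin d) × EuclideanSpace ℝ (Fin d) =>
        M.h φ z.1 z.2 x) z‖ ≤ H x

/-- Moments: at `(θT, θT)` all first order partial derivatives of `h` (in `θ` and in `α`) are
square integrable, all second order ones (`θθ`, `αα` and mixed) are integrable, with respect to
`P_{θT}`, and the Fisher information matrix at `θT` is nonsingular. -/
structure MomentCondition (θT : EuclideanSpace ℝ (Fin d)) : Prop where
  first : Integrable (fun x =>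
    ‖iteratedFDeriv ℝ 1 (fun z : EuclideanSpace ℝ (Fin d) × EuclideanSpace ℝ (Fin d) =>
      M.h φ z.1 z.2 x) (θT, θT)‖ ^ 2) (M.P θT)
  second : Integrable (fun x =>
    ‖iteratedFDeriv ℝ 2 (fun z : EuclideanSpace ℝ (Fin d) × EuclideanSpace ℝ (Fin d) =>
      M.h φ z.1 z.2 x) (θT, θT)‖) (M.P θT)
  fisher_nonsingular : (M.fisherInfo θT).det ≠ 0

/-! ### Empirical quantities -/

variable {Ω : Type*} (X : ℕ → Ω → 𝒳)

/-- `P_n h(θ, α)`, the mean of `h(θ, α)` over the sample `X 0, …, X (n - 1)`. -/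
def empH (n : ℕ) (ω : Ω) (θ α : EuclideanSpace ℝ (Fin d)) : ℝ :=
  (n : ℝ)⁻¹ * ∑ i ∈ Finset.range n, M.h φ θ α (X i ω)

/-- The estimate `sup_{α ∈ Θ} P_n h(θ, α)` of the divergence between `P_θ` and `P_{θT}`. -/
def dualDiv (n : ℕ) (ω : Ω) (θ : EuclideanSpace ℝ (Fin d)) : EReal :=
  ⨆ α ∈ M.Θ, (M.empH φ X n ω θ α : EReal)

/-- The estimate `inf_{θ ∈ Θ₀} sup_{α ∈ Θ} P_n h(θ, α)` of the divergence between
`{P_θ : θ ∈ Θ₀}` and `P_{θT}`. -/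
def dualDivOn (Θ₀ : Set (EuclideanSpace ℝ (Fin d))) (n : ℕ) (ω : Ω) : EReal :=
  ⨅ θ ∈ Θ₀, M.dualDiv φ X n ω θ

/-- The test statistic `(2n / φ''(1)) inf_{θ ∈ Θ₀} sup_{α ∈ Θ} P_n h(θ, α)`. -/
def testStat (Θ₀ : Set (EuclideanSpace ℝ (Fin d))) (n : ℕ) (ω : Ω) : ℝ :=
  2 * n / phiDeriv2 φ 1 * (M.dualDivOn φ X Θ₀ n ω).toReal

/-- The log-likelihood of the sample `X 0, …, X (n - 1)`. -/
def logLik (n : ℕ) (ω : Ω) (θ : EuclideanSpace ℝ (Fin d)) : ℝ :=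
  ∑ i ∈ Finset.range n, Real.log (M.p θ (X i ω))

/-- The generalized likelihood ratio statistic, twice the logarithm of the ratio of the maximum
likelihoods over `Θ` and over `Θ₀`. -/
def genLikRatioStat (Θ₀ : Set (EuclideanSpace ℝ (Fin d))) (n : ℕ) (ω : Ω) : ℝ :=
  2 * ((⨆ α ∈ M.Θ, (M.logLik X n ω α : EReal)) - ⨆ θ ∈ Θ₀, (M.logLik X n ω θ : EReal)).toReal

/-- The estimators over `Θ₀` exist, with probability tending to one, and are consistent:
`θhat n` minimizes `θ ↦ sup_{α ∈ Θ} P_n h(θ, α)` over `Θ₀` and tends to `θT` in probability;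
`αhat n θ` maximizes `P_n h(θ, ·)` over `Θ` for every `θ ∈ Θ₀` in some neighbourhood `U` of `θT`,
and tends to `θT` in probability, uniformly in these `θ`.
Sets that may fail to be measurable are measured by the outer measure. -/
structure ConsistentEstimators [MeasurableSpace Ω] (μ : Measure Ω)
    (θT : EuclideanSpace ℝ (Fin d)) (Θ₀ : Set (EuclideanSpace ℝ (Fin d)))
    (θhat : ℕ → Ω → EuclideanSpace ℝ (Fin d))
    (αhat : ℕ → Ω → EuclideanSpace ℝ (Fin d) → EuclideanSpace ℝ (Fin d))
    (U : Set (EuclideanSpace ℝ (Fin d))) : Prop where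
  exists_θ : Tendsto (fun n => μ {ω | ¬ (θhat n ω ∈ Θ₀ ∧
    IsMinOn (M.dualDiv φ X n ω) Θ₀ (θhat n ω))}) atTop (𝓝 0)
  consistent_θ : TendstoInMeasure μ θhat atTop fun _ => θT
  exists_α : Tendsto (fun n => μ {ω | ¬ ∀ θ ∈ Θ₀ ∩ U, αhat n ω θ ∈ M.Θ ∧
    IsMaxOn (M.empH φ X n ω θ) M.Θ (αhat n ω θ)}) atTop (𝓝 0)
  consistent_α : ∀ ε : ℝ, 0 < ε →
    Tendsto (fun n => μ {ω | ∃ θ ∈ Θ₀ ∩ U, ε ≤ ‖αhat n ω θ - θT‖}) atTop (𝓝 0)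

end ParametricModel

/-! ### Smooth hypotheses and the chi-square law -/

/-- `Θ₀ ⊆ Θ` is a `(d - l)`-dimensional smooth subset: it is the image `s(B₀)` of an open set
`B₀` of `ℝ^(d-l)` under a continuously differentiable map `s` whose derivative has rank `d - l`,
and it is contained in the zero set of a map `r : Θ → ℝ^l` whose derivative exists, is continuous
and has rank `l`. -/
structure IsSmoothHypothesis {d l : ℕ} (Θ Θ₀ : Set (EuclideanSpace ℝ (Fin d)))
    (B₀ : Set (EuclideanSpace ℝ (Fin (d - l))))
    (s : EuclideanSpace ℝ (Fin (d - l)) → EuclideanSpace ℝ (Fin d))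
    (r : EuclideanSpace ℝ (Fin d) → EuclideanSpace ℝ (Fin l)) : Prop where
  le : l ≤ d
  subset : Θ₀ ⊆ Θ
  isOpen_B₀ : IsOpen B₀
  image_eq : s '' B₀ = Θ₀
  contDiffOn_s : ContDiffOn ℝ 1 s B₀
  rank_s : ∀ β ∈ B₀, Module.finrank ℝ (LinearMap.range (fderiv ℝ s β).toLinearMap) = d - l
  contDiffOn_r : ContDiffOn ℝ 1 r (interior Θ)
  rank_r : ∀ θ ∈ interior Θ, Module.finrank ℝ (LinearMap.range (fderiv ℝ r θ).toLinearMap) = l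
  eq_zero : ∀ θ ∈ Θ₀, r θ = 0

/-- The chi-square distribution with `l` degrees of freedom: the law of the sum of the squares of
`l` independent standard normal variables. -/
def chiSquare (l : ℕ) : Measure ℝ :=
  (Measure.pi fun _ : Fin l => gaussianReal 0 1).map fun z => ∑ i, z i ^ 2

instance isProbabilityMeasure_chiSquare (l : ℕ) : IsProbabilityMeasure (chiSquare l) :=
  Measure.isProbabilityMeasure_map
    (Finset.measurable_fun_sum _ fun i _ => (measurable_pi_apply i).pow_const 2).aemeasurable

end

/-! Write c = φ''(1), let I be the Fisher information at θT and let A be its square root, and use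
the coordinates u = A(θ - θT), v = A(α - θT). At (θT, θT) the function h vanishes. Its first
derivative is c times the score applied to the difference of the two increments
(`ae_fderiv_h_apply`), and the mean of its second derivative is c(‖u‖² - ‖v‖²), without cross terms
(`integral_fderiv_fderiv_h`). Let Z be the empirical mean of the whitened scores. The law of large
numbers for the second derivatives and for the third order bound gives, near the origin, P_n h / c ≈
⟨Z, v - u⟩ + (‖u‖² - ‖v‖²)/2 = ‖u - Z‖²/2 - ‖v - Z‖²/2, with error at most η(‖u‖² + ‖v‖²), on events
whose probability tends to one (`exists_empH_expansion`).

The supremum over v is therefore close to ‖u - Z‖²/2. In these coordinates Θ₀ is, up to a relative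
error η, a linear subspace T of dimension d - l (`exists_tangent`), so the infimum over u is close
to half the squared distance from Z to T, which is half the squared norm of the projection of Z on
Tᗮ. Hence T_n is close to the squared norm of the projection of √n Z on Tᗮ, a space of dimension l.
The central limit theorem makes √n Z asymptotically standard Gaussian, and the chi-square limit
follows by Slutsky's lemma.

Only consistency of the estimators is needed, without any rate. All errors are relative, so
optimality alone bounds the minimiser by a multiple of ‖Z‖ and the total error by a multiple of η
n‖Z‖² (`abs_min_sub_dist_le`, `abs_testStat_sub_le`). As n‖Z‖² is bounded in probability and η is
arbitrary, this error is negligible.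

For φ = `phiKLm`, p_θ φ'(p_θ/p_α) = p_θ - p_α integrates to zero, so h is the difference of the
log-densities and the minimax splits into a difference of two suprema. -/

noncomputable section

/-! ### Averages of functions of an i.i.d. sample -/

section Sample

variable {𝒳 Ω : Type*} [MeasurableSpace 𝒳] [MeasurableSpace Ω] {P : Measure 𝒳}
  {μ : Measure Ω} {X : ℕ → Ω → 𝒳}

theorem ae_forall_sample (hX : ∀ i, Measurable (X i)) (hlaw : ∀ i, μ.map (X i) = P)
    {q : 𝒳 → Prop} (hq : ∀ᵐ x ∂P, q x) : ∀ᵐ ω ∂μ, ∀ i, q (X i ω) := by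
  refine ae_all_iff.2 fun i => ?_
  rw [← hlaw i] at hq
  exact ae_of_ae_map (hX i).aemeasurable hq

theorem strong_law_sample {F : Type*} [NormedAddCommGroup F] [NormedSpace ℝ F] [CompleteSpace F]
    (hX : ∀ i, Measurable (X i)) (hindep : iIndepFun X μ) (hlaw : ∀ i, μ.map (X i) = P)
    {Y : 𝒳 → F} (hY : StronglyMeasurable Y) (hYi : Integrable Y P) :
    ∀ᵐ ω ∂μ, Tendsto (fun n : ℕ => (n : ℝ)⁻¹ • ∑ i ∈ Finset.range n, Y (X i ω)) atTop
      (𝓝 (∫ x, Y x ∂P)) := by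
  borelize F
  have h1 := strong_law_ae (μ := μ) (fun i ω => Y (X i ω)) ?_ ?_ ?_
  · rw [← hlaw 0, integral_map (hX 0).aemeasurable hY.aestronglyMeasurable]
    exact h1
  · rw [← hlaw 0] at hYi
    exact hYi.comp_measurable (hX 0)
  · intro i j hij
    exact (hindep.indepFun hij).comp hY.measurable hY.measurable
  · intro i
    have : IdentDistrib (X i) (X 0) μ μ :=
      ⟨(hX i).aemeasurable, (hX 0).aemeasurable, by rw [hlaw, hlaw]⟩
    exact this.comp hY.measurable

variable [IsProbabilityMeasure μ]

theorem strong_law_sample_measure {F : Type*} [NormedAddCommGroup F] [NormedSpace ℝ F]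
    [CompleteSpace F] (hX : ∀ i, Measurable (X i)) (hindep : iIndepFun X μ)
    (hlaw : ∀ i, μ.map (X i) = P) {Y : 𝒳 → F} (hY : StronglyMeasurable Y) (hYi : Integrable Y P)
    {δ : ℝ} (hδ : 0 < δ) :
    Tendsto (fun n : ℕ => μ {ω | δ ≤
      ‖(n : ℝ)⁻¹ • ∑ i ∈ Finset.range n, Y (X i ω) - ∫ x, Y x ∂P‖}) atTop (𝓝 0) := by
  have h := tendstoInMeasure_of_tendsto_ae (μ := μ)
    (f := fun (n : ℕ) ω => (n : ℝ)⁻¹ • ∑ i ∈ Finset.range n, Y (X i ω))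
    (g := fun _ => ∫ x, Y x ∂P) (fun n => ?_) (strong_law_sample hX hindep hlaw hY hYi)
  · exact tendstoInMeasure_iff_norm.1 h δ hδ
  · refine AEStronglyMeasurable.const_smul ?_ _
    exact Finset.aestronglyMeasurable_fun_sum _ fun i _ =>
      (hY.comp_measurable (hX i)).aestronglyMeasurable

variable {E : Type*} [NormedAddCommGroup E] [InnerProductSpace ℝ E] [FiniteDimensional ℝ E]
  [MeasurableSpace E] [BorelSpace E]

/-- The central limit theorem for a centered vector with identity covariance. -/
theorem tendstoInDistribution_stdGaussian (hX : ∀ i, Measurable (X i)) (hindep : iIndepFun X μ)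
    (hlaw : ∀ i, μ.map (X i) = P) {Y : 𝒳 → E} (hY : Measurable Y)
    (h0 : ∀ w, ∫ x, inner ℝ (Y x) w ∂P = 0) (h1 : ∀ w, ∫ x, inner ℝ (Y x) w ^ 2 ∂P = ‖w‖ ^ 2) :
    TendstoInDistribution (fun (n : ℕ) ω => (√n)⁻¹ • ∑ i ∈ Finset.range n, Y (X i ω)) atTop id
      (fun _ => μ) (stdGaussian E) where
  forall_aemeasurable n := by
    refine AEMeasurable.const_smul ?_ _
    exact Finset.aemeasurable_fun_sum _ fun i _ => (hY.comp (hX i)).aemeasurable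
  tendsto := by
    refine ProbabilityMeasure.tendsto_iff_tendsto_charFun.2 fun t => ?_
    simp only [ProbabilityMeasure.coe_mk, Measure.map_id, charFun_stdGaussian]
    have hmeas (n : ℕ) : AEMeasurable (fun ω => (√n)⁻¹ • ∑ i ∈ Finset.range n, Y (X i ω)) μ := by
      refine AEMeasurable.const_smul ?_ _
      exact Finset.aemeasurable_fun_sum _ fun i _ => (hY.comp (hX i)).aemeasurable
    rcases eq_or_ne t 0 with rfl | ht
    · simp only [charFun_zero]
      refine tendsto_nhds_of_eventually_eq (Eventually.of_forall fun n => ?_)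
      have := Measure.isProbabilityMeasure_map (hmeas n)
      simp
    have ht' : ‖t‖ ≠ 0 := norm_ne_zero_iff.2 ht
    -- Cramér–Wold: the one-dimensional theorem is applied along the unit vector u, for which the
    -- variance is 1, and the characteristic function is read at the real point ‖t‖. This is why t =
    -- 0 is treated apart.
    set u : E := ‖t‖⁻¹ • t with hu
    have hun : ‖u‖ = 1 := by rw [hu, norm_smul, norm_inv, norm_norm, inv_mul_cancel₀ ht']
    have htu : t = ‖t‖ • u := by rw [hu, smul_smul, mul_inv_cancel₀ ht', one_smul]
    have hYu : Measurable fun x => (inner ℝ (Y x) u : ℝ) := by fun_prop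
    have hX' : ∀ i, AEMeasurable (X i) μ := fun i => (hX i).aemeasurable
    have hC := tendstoInDistribution_inv_sqrt_mul_sum (P := μ) (P' := gaussianReal 0 1) (Y := id)
      (X := fun i ω => inner ℝ (Y (X i ω)) u) ⟨by fun_prop, by simp⟩ ?_ ?_ ?_ ?_
    · have := ProbabilityMeasure.tendsto_iff_tendsto_charFun.1 hC.tendsto ‖t‖
      simp only [ProbabilityMeasure.coe_mk, Measure.map_id, charFun_gaussianReal] at this
      convert this using 2 with n
      · rw [charFun_apply, charFun_apply, integral_map (hmeas n) (by fun_prop),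
          integral_map _ (by fun_prop)]
        · refine integral_congr_ae (ae_of_all _ fun ω => ?_)
          simp only
          congr 3
          conv_lhs => rw [htu]
          rw [inner_smul_right, inner_smul_left, sum_inner]
          simp
        · exact (Finset.aemeasurable_fun_sum _ fun i _ =>
            (hYu.comp (hX i)).aemeasurable).const_mul _
      · push_cast; ring_nf
    · rw [← h0 u, ← hlaw 0, integral_map (hX' 0) hYu.aestronglyMeasurable]
    · have := h1 u
      rw [hun, ← hlaw 0, integral_map (hX' 0) (hYu.pow_const 2).aestronglyMeasurable] at this
      simpa using this
    · exact hindep.comp (fun _ x => inner ℝ (Y x) u) fun _ => hYu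
    · intro i
      have : IdentDistrib (X i) (X 0) μ μ := ⟨hX' i, hX' 0, by rw [hlaw, hlaw]⟩
      exact this.comp hYu

end Sample

/-! ### Minimisation of perturbed quadratic functions -/

section Quadratic

variable {E : Type*} [NormedAddCommGroup E]

/-- Squaring the hypothesis is legitimate only when a - 3ηb is nonnegative. Otherwise a² ≤ 3ηab ≤
3ηb², and the left-hand side is already nonpositive. -/
theorem sq_sub_le_of_sub_le {a b c η : ℝ} (hη : 0 ≤ η) (ha : 0 ≤ a) (hab : a ≤ b)
    (h : a - 3 * (η * b) ≤ c) : a ^ 2 - 6 * η * b ^ 2 ≤ c ^ 2 := by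
  have h1 : η * b * a ≤ η * b * b := mul_le_mul_of_nonneg_left hab (mul_nonneg hη (ha.trans hab))
  rcases le_total 0 (a - 3 * (η * b)) with h2 | h2
  · have := pow_le_pow_left₀ h2 h 2
    nlinarith [sq_nonneg (η * b)]
  · have h3 : a * (a - 3 * (η * b)) ≤ 0 := mul_nonpos_of_nonneg_of_nonpos ha h2
    nlinarith [sq_nonneg c, mul_nonneg hη (sq_nonneg b)]

/-- The supremum over `v` of a function close to `½‖u - ζ‖² - ½‖v - ζ‖²` is close to
`½‖u - ζ‖²`. -/
theorem abs_max_sub_quadratic_le {q : E → ℝ} {u ζ v : E} {η ε : ℝ} (hη : η ≤ 1 / 4)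
    (hζ : ‖ζ‖ ≤ ε) (hv : ‖v‖ ≤ ε)
    (happ : ∀ w, ‖w‖ ≤ ε →
      |q w - (‖u - ζ‖ ^ 2 / 2 - ‖w - ζ‖ ^ 2 / 2)| ≤ η * (‖u‖ ^ 2 + ‖w‖ ^ 2))
    (hmax : q ζ ≤ q v) (hη0 : 0 ≤ η) :
    |q v - ‖u - ζ‖ ^ 2 / 2| ≤ η * (‖u‖ ^ 2 + 2 * ‖ζ‖ ^ 2) := by
  have h1 := abs_le.1 (happ ζ hζ)
  have h2 := abs_le.1 (happ v hv)
  simp only [sub_self, norm_zero] at h1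
  have h3 : ‖v‖ ≤ ‖v - ζ‖ + ‖ζ‖ := by simpa using norm_add_le (v - ζ) ζ
  have h4 : ‖v‖ ^ 2 ≤ 2 * ‖v - ζ‖ ^ 2 + 2 * ‖ζ‖ ^ 2 := by
    nlinarith [norm_nonneg v, sq_nonneg (‖v - ζ‖ - ‖ζ‖), norm_nonneg (v - ζ), norm_nonneg ζ]
  -- The part of the error that depends on v is absorbed by the concave term -‖v - ζ‖²/2; this uses
  -- η ≤ 1/4. The lower bound comes from the competitor ζ.
  have h5 : η * ‖v‖ ^ 2 ≤ ‖v - ζ‖ ^ 2 / 2 + 2 * η * ‖ζ‖ ^ 2 := by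
    nlinarith [mul_le_mul_of_nonneg_left h4 hη0, sq_nonneg (‖v - ζ‖),
      mul_le_mul_of_nonneg_right hη (sq_nonneg ‖v - ζ‖)]
  have h6 : 0 ≤ η * ‖ζ‖ ^ 2 := by positivity
  rw [abs_le]
  constructor <;> nlinarith [h1.1, h2.2]

variable [InnerProductSpace ℝ E]

/-- The minimum, over a set close to the subspace `T` near the origin, of a function close to
`½‖u - ζ‖²` is close to half the squared distance from `ζ` to `T`. -/
theorem abs_min_sub_dist_le {K : Set E} (T : Submodule ℝ E) [T.HasOrthogonalProjection]
    {D : E → ℝ} {ζ u : E} {η ε : ℝ} (hη0 : 0 ≤ η) (hη : η ≤ 1 / 16) (hζ : ‖ζ‖ ≤ ε / 2)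
    (hTK : ∀ τ ∈ T, ‖τ‖ ≤ ε → ∃ w ∈ K, ‖w - τ‖ ≤ η * ‖τ‖)
    (hKT : ∀ w ∈ K, ‖w‖ ≤ ε → ∃ τ ∈ T, ‖w - τ‖ ≤ η * ‖w‖)
    (hD : ∀ w ∈ K, ‖w‖ ≤ ε → |D w - ‖w - ζ‖ ^ 2 / 2| ≤ η * (‖w‖ ^ 2 + 2 * ‖ζ‖ ^ 2))
    (huK : u ∈ K) (hu : ‖u‖ ≤ ε) (hmin : ∀ w ∈ K, ‖w‖ ≤ ε → D u ≤ D w) :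
    |D u - ‖Tᗮ.starProjection ζ‖ ^ 2 / 2| ≤ 14 * η * ‖ζ‖ ^ 2 := by
  have hdec : T.starProjection ζ + Tᗮ.starProjection ζ = ζ :=
    Submodule.starProjection_add_starProjection_orthogonal ζ
  set τ := T.starProjection ζ with hτ
  set ρ := Tᗮ.starProjection ζ with hρ
  have hτT : τ ∈ T := Submodule.starProjection_apply_mem _ _
  have hρT : ρ ∈ Tᗮ := Submodule.starProjection_apply_mem _ _
  have hτn : ‖τ‖ ≤ ‖ζ‖ := Submodule.norm_starProjection_apply_le _ _
  have hρn : ‖ρ‖ ≤ ‖ζ‖ := Submodule.norm_starProjection_apply_le _ _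
  have hζ0 := norm_nonneg ζ
  have hρ0 := norm_nonneg ρ
  have hτ0 := norm_nonneg τ
  have hε : 0 ≤ ε := by linarith
  -- The point of K next to the projection of ζ on T is the competitor that gives the upper bound.
  obtain ⟨w, hwK, hw⟩ := hTK τ hτT (by linarith)
  have hwτ : ‖w - τ‖ ≤ η * ‖ζ‖ := hw.trans (mul_le_mul_of_nonneg_left hτn hη0)
  have hwn : ‖w‖ ≤ (1 + η) * ‖ζ‖ := by
    have : ‖w‖ ≤ ‖w - τ‖ + ‖τ‖ := by simpa using norm_add_le (w - τ) τ
    linarith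
  have hwε : ‖w‖ ≤ ε := hwn.trans (by linarith [mul_le_mul_of_nonneg_right hη hζ0])
  have hwζ : ‖w - ζ‖ ≤ η * ‖ζ‖ + ‖ρ‖ := by
    have : w - ζ = (w - τ) - ρ := by rw [← hdec]; abel
    rw [this]
    exact (norm_sub_le _ _).trans (by linarith)
  have hDw := (abs_le.1 (hD w hwK hwε)).2
  have hw0 := norm_nonneg w
  have hwζ0 := norm_nonneg (w - ζ)
  have hηζ : 0 ≤ η * ‖ζ‖ ^ 2 := by positivity
  have hub : D u ≤ ‖ρ‖ ^ 2 / 2 + 8 * η * ‖ζ‖ ^ 2 := by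
    have e1 : ‖w - ζ‖ ^ 2 ≤ (η * ‖ζ‖ + ‖ρ‖) ^ 2 := pow_le_pow_left₀ hwζ0 hwζ 2
    have e2 : ‖w‖ ^ 2 ≤ (2 * ‖ζ‖) ^ 2 := pow_le_pow_left₀ hw0 (hwn.trans (by gcongr; linarith)) 2
    have e3 : η * ‖ζ‖ * ‖ρ‖ ≤ η * ‖ζ‖ * ‖ζ‖ := mul_le_mul_of_nonneg_left hρn (by positivity)
    have e4 := mul_le_mul_of_nonneg_left e2 hη0
    have e5 : η * (η * ‖ζ‖ ^ 2) ≤ (1 / 16) * (η * ‖ζ‖ ^ 2) := mul_le_mul_of_nonneg_right hη hηζ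
    linarith [hmin w hwK hwε]
  have hDu := (abs_le.1 (hD u huK hu)).1
  have hu0 := norm_nonneg u
  have huζ0 := norm_nonneg (u - ζ)
  have hρ2 : ‖ρ‖ ^ 2 ≤ ‖ζ‖ ^ 2 := pow_le_pow_left₀ hρ0 hρn 2
  -- Optimality bounds the minimiser by a multiple of ‖ζ‖, through the quadratic growth of ‖u - ζ‖²;
  -- this replaces a rate of convergence.
  have hun : ‖u‖ ≤ 3 * ‖ζ‖ := by
    have e1 : ‖u‖ ≤ ‖u - ζ‖ + ‖ζ‖ := by simpa using norm_add_le (u - ζ) ζ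
    have e2 : ‖u‖ ^ 2 ≤ 2 * ‖u - ζ‖ ^ 2 + 2 * ‖ζ‖ ^ 2 := by
      have := pow_le_pow_left₀ hu0 e1 2
      linarith [sq_nonneg (‖u - ζ‖ - ‖ζ‖)]
    have e3 : η * ‖ζ‖ ^ 2 ≤ (1 / 16) * ‖ζ‖ ^ 2 := mul_le_mul_of_nonneg_right hη (sq_nonneg _)
    have e4 : η * ‖u‖ ^ 2 ≤ (1 / 16) * ‖u‖ ^ 2 := mul_le_mul_of_nonneg_right hη (sq_nonneg _)
    have e5 : ‖u‖ ^ 2 ≤ (3 * ‖ζ‖) ^ 2 := by linarith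
    exact le_of_sq_le_sq e5 (by positivity)
  obtain ⟨t, htT, ht⟩ := hKT u huK hu
  have hut : ‖u - t‖ ≤ 3 * (η * ‖ζ‖) := by linarith [mul_le_mul_of_nonneg_left hun hη0]
  -- By Pythagoras, no point of T is closer to ζ than its projection.
  have htρ : ‖ρ‖ ≤ ‖t - ζ‖ := by
    have e : t - ζ = (t - τ) - ρ := by rw [← hdec]; abel
    have hor : inner ℝ (t - τ) ρ = 0 :=
      Submodule.inner_right_of_mem_orthogonal (T.sub_mem htT hτT) hρT
    have : ‖t - ζ‖ ^ 2 = ‖t - τ‖ ^ 2 + ‖ρ‖ ^ 2 := by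
      rw [e, norm_sub_sq_real, hor]; ring
    exact le_of_sq_le_sq (by rw [this]; linarith [sq_nonneg ‖t - τ‖]) (norm_nonneg _)
  have huρ : ‖ρ‖ - 3 * (η * ‖ζ‖) ≤ ‖u - ζ‖ := by
    have : ‖t - ζ‖ ≤ ‖u - ζ‖ + ‖u - t‖ := by
      have e : t - ζ = (u - ζ) - (u - t) := by abel
      rw [e]; exact norm_sub_le _ _
    linarith
  have hlb : ‖ρ‖ ^ 2 - 6 * η * ‖ζ‖ ^ 2 ≤ ‖u - ζ‖ ^ 2 :=
    sq_sub_le_of_sub_le hη0 hρ0 hρn huρ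
  have hu2 : ‖u‖ ^ 2 ≤ 9 * ‖ζ‖ ^ 2 := by
    have := pow_le_pow_left₀ hu0 hun 2
    linarith
  -- In the lower bound, 14 = 3 + 9 + 2: half of the 6η of `hlb`, then η‖u‖² ≤ 9η‖ζ‖², then the term
  -- 2η‖ζ‖² of `hD`. The upper bound only needs 8.
  have := mul_le_mul_of_nonneg_left hu2 hη0
  rw [abs_le]
  constructor <;> linarith

end Quadratic

/-! ### Tangent spaces of smooth hypotheses -/

section Tangent

variable {d l : ℕ} {Θ Θ₀ : Set (EuclideanSpace ℝ (Fin d))}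
  {B₀ : Set (EuclideanSpace ℝ (Fin (d - l)))}
  {s : EuclideanSpace ℝ (Fin (d - l)) → EuclideanSpace ℝ (Fin d)}
  {r : EuclideanSpace ℝ (Fin d) → EuclideanSpace ℝ (Fin l)}

/-- The image of the derivative of the parametrisation is the kernel of that of the constraint. -/
theorem IsSmoothHypothesis.range_eq_ker (h : IsSmoothHypothesis Θ Θ₀ B₀ s r)
    {β : EuclideanSpace ℝ (Fin (d - l))} (hβ : β ∈ B₀) (hs : s β ∈ interior Θ) :
    LinearMap.range (fderiv ℝ s β).toLinearMap = LinearMap.ker (fderiv ℝ r (s β)).toLinearMap := by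
  have hds : HasFDerivAt s (fderiv ℝ s β) β :=
    ((h.contDiffOn_s.contDiffAt (h.isOpen_B₀.mem_nhds hβ)).differentiableAt one_ne_zero).hasFDerivAt
  have hdr : HasFDerivAt r (fderiv ℝ r (s β)) (s β) :=
    ((h.contDiffOn_r.contDiffAt (isOpen_interior.mem_nhds hs)).differentiableAt
      one_ne_zero).hasFDerivAt
  -- The composite r ∘ s vanishes near β, which gives one inclusion; the two ranks then force
  -- equality of dimensions.
  have hcomp : (fderiv ℝ r (s β)).comp (fderiv ℝ s β) = 0 := by
    refine (hdr.comp β hds).unique ?_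
    refine (hasFDerivAt_const (0 : EuclideanSpace ℝ (Fin l)) β).congr_of_eventuallyEq ?_
    filter_upwards [h.isOpen_B₀.mem_nhds hβ] with b hb
    exact h.eq_zero _ (h.image_eq ▸ Set.mem_image_of_mem s hb)
  refine Submodule.eq_of_le_of_finrank_eq ?_ ?_
  · rintro _ ⟨b, rfl⟩
    exact DFunLike.congr_fun hcomp b
  · have h1 := LinearMap.finrank_range_add_finrank_ker (fderiv ℝ r (s β)).toLinearMap
    rw [h.rank_r _ hs, finrank_euclideanSpace_fin] at h1
    rw [h.rank_s _ hβ]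
    omega

/-- T is the image under A of the range of s', which is also the kernel of r'. Differentiability of
s produces a point of Θ₀ next to each small tangent vector. The converse approximation uses r
instead: s is not assumed to be a homeomorphism onto its image, so points of Θ₀ near θT may come
from parameters far from β. -/
theorem IsSmoothHypothesis.exists_tangent (h : IsSmoothHypothesis Θ Θ₀ B₀ s r)
    {θT : EuclideanSpace ℝ (Fin d)} (hθ : θT ∈ Θ₀) (hΘ : θT ∈ interior Θ)
    (A : EuclideanSpace ℝ (Fin d) ≃L[ℝ] EuclideanSpace ℝ (Fin d)) :
    ∃ T : Submodule ℝ (EuclideanSpace ℝ (Fin d)), Module.finrank ℝ T = d - l ∧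
      ∀ η : ℝ, 0 < η → ∃ ρ > 0,
        (∀ τ ∈ T, ‖τ‖ ≤ ρ → ∃ θ ∈ Θ₀, ‖A (θ - θT) - τ‖ ≤ η * ‖τ‖) ∧
        (∀ θ ∈ Θ₀, ‖A (θ - θT)‖ ≤ ρ → ∃ τ ∈ T, ‖A (θ - θT) - τ‖ ≤ η * ‖A (θ - θT)‖) := by
  obtain ⟨β, hβ, rfl⟩ := h.image_eq.symm ▸ hθ
  set L := fderiv ℝ s β with hL
  set G := fderiv ℝ r (s β) with hG
  have hker : LinearMap.range L.toLinearMap = LinearMap.ker G.toLinearMap := h.range_eq_ker hβ hΘ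
  have hds : HasFDerivAt s L β :=
    ((h.contDiffOn_s.contDiffAt (h.isOpen_B₀.mem_nhds hβ)).differentiableAt one_ne_zero).hasFDerivAt
  have hdr : HasFDerivAt r G (s β) :=
    ((h.contDiffOn_r.contDiffAt (isOpen_interior.mem_nhds hΘ)).differentiableAt
      one_ne_zero).hasFDerivAt
  have hinj : LinearMap.ker L.toLinearMap = ⊥ := by
    have h1 := LinearMap.finrank_range_add_finrank_ker L.toLinearMap
    rw [h.rank_s _ hβ, finrank_euclideanSpace_fin] at h1
    exact Submodule.finrank_eq_zero.1 (by omega)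
  have hsurj : LinearMap.range G.toLinearMap = ⊤ :=
    Submodule.eq_top_of_finrank_eq (by rw [h.rank_r _ hΘ, finrank_euclideanSpace_fin])
  refine ⟨(LinearMap.range L.toLinearMap).map A.toLinearEquiv.toLinearMap, ?_, fun η hη => ?_⟩
  · rw [LinearEquiv.finrank_map_eq]
    exact h.rank_s _ hβ
  -- C bounds the inverse of L on its range, and the right inverse of G will correct a displacement
  -- into the kernel of G. The summands +1 in the denominators below allow the operator norms to be
  -- zero.
  obtain ⟨C, hC, hLC⟩ := L.toLinearMap.exists_antilipschitzWith hinj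
  obtain ⟨R, hR⟩ := G.toLinearMap.exists_rightInverse_of_surjective hsurj
  set R' := LinearMap.toContinuousLinearMap R with hR'
  have hGR : ∀ y, G (R' y) = y := fun y => DFunLike.congr_fun hR y
  have hAs : ∀ v, ‖v‖ ≤ ‖(A.symm : EuclideanSpace ℝ (Fin d) →L[ℝ] EuclideanSpace ℝ (Fin d))‖ * ‖A v‖ := fun v => by
    simpa using (A.symm : EuclideanSpace ℝ (Fin d) →L[ℝ] EuclideanSpace ℝ (Fin d)).le_opNorm (A v)
  set a := ‖(A : EuclideanSpace ℝ (Fin d) →L[ℝ] EuclideanSpace ℝ (Fin d))‖ with ha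
  set a' := ‖(A.symm : EuclideanSpace ℝ (Fin d) →L[ℝ] EuclideanSpace ℝ (Fin d))‖ with ha'
  have hA : ∀ v, ‖A v‖ ≤ a * ‖v‖ := (A : EuclideanSpace ℝ (Fin d) →L[ℝ] EuclideanSpace ℝ (Fin d)).le_opNorm
  have ha0 : 0 ≤ a := norm_nonneg _
  have ha0' : 0 ≤ a' := norm_nonneg _
  have hLC' : ∀ b, ‖b‖ ≤ C * ‖L b‖ := fun b => by
    have := hLC.le_mul_dist b 0
    simpa using this
  have hC0 : (0 : ℝ) ≤ C := C.2
  obtain ⟨δ₁, hδ₁, hs₁⟩ := Metric.eventually_nhds_iff.1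
    ((hasFDerivAt_iff_isLittleO_nhds_zero.1 hds).def
      (c := η / (a * (C * a') + 1)) (by positivity))
  obtain ⟨δ₂, hδ₂, hr₂⟩ := Metric.eventually_nhds_iff.1
    ((hasFDerivAt_iff_isLittleO_nhds_zero.1 hdr).def (c := η / (a * ‖R'‖ * a' + 1)) (by positivity))
  obtain ⟨δ₃, hδ₃, hB₃⟩ := Metric.mem_nhds_iff.1 (h.isOpen_B₀.mem_nhds hβ)
  refine ⟨min (min δ₁ δ₃ / (C * a' + 1) / 2) (δ₂ / (a' + 1) / 2), by positivity, ?_, ?_⟩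
  · rintro _ ⟨_, ⟨b, rfl⟩, rfl⟩ hτ
    replace hτ := hτ.trans (min_le_left _ _)
    change ‖A (L b)‖ ≤ _ at hτ
    have hb : ‖b‖ ≤ C * a' * ‖A (L b)‖ := by
      calc ‖b‖ ≤ C * ‖L b‖ := hLC' b
        _ ≤ C * (a' * ‖A (L b)‖) := by gcongr; exact hAs _
        _ = _ := by ring
    have hbδ : ‖b‖ < min δ₁ δ₃ := by
      have h0 : 0 < min δ₁ δ₃ := lt_min hδ₁ hδ₃
      calc ‖b‖ ≤ (C * a' + 1) * (min δ₁ δ₃ / (C * a' + 1) / 2) := by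
            refine hb.trans ?_
            gcongr
            linarith
        _ = min δ₁ δ₃ / 2 := by field_simp
        _ < _ := by linarith
    have hbB : β + b ∈ B₀ := hB₃ (by simpa using hbδ.trans_le (min_le_right _ _))
    refine ⟨s (β + b), h.image_eq ▸ Set.mem_image_of_mem s hbB, ?_⟩
    have h1 := hs₁ (y := b) (by simpa using hbδ.trans_le (min_le_left _ _))
    change ‖A (s (β + b) - s β) - A (L b)‖ ≤ η * ‖A (L b)‖
    rw [← map_sub]
    calc ‖A (s (β + b) - s β - L b)‖ ≤ a * ‖s (β + b) - s β - L b‖ := hA _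
      _ ≤ a * (η / (a * (C * a') + 1) * (C * a' * ‖A (L b)‖)) := by
          gcongr
          exact h1.trans (by gcongr)
      _ = η * (a * (C * a') / (a * (C * a') + 1)) * ‖A (L b)‖ := by ring
      _ ≤ η * 1 * ‖A (L b)‖ := by
          gcongr
          exact (div_le_one (by positivity)).2 (by linarith)
      _ = _ := by ring
  · intro θ hθ₀ hτ
    replace hτ := hτ.trans (min_le_right _ _)
    have hv := hAs (θ - s β)
    have hvδ : ‖θ - s β‖ < δ₂ := by
      calc ‖θ - s β‖ ≤ (a' + 1) * (δ₂ / (a' + 1) / 2) := by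
            refine hv.trans ?_
            gcongr
            linarith
        _ = δ₂ / 2 := by field_simp
        _ < _ := by linarith
    have h1 := hr₂ (y := θ - s β) (by simpa using hvδ)
    rw [add_sub_cancel, h.eq_zero θ hθ₀, h.eq_zero (s β) hθ, sub_zero, zero_sub, norm_neg] at h1
    -- Subtracting R'(G v) from v = θ - s β lands in the kernel. The correction is small relative to
    -- v because r vanishes at both ends, so that G v is the remainder of the first order expansion
    -- of r.
    refine ⟨A (θ - s β - R' (G (θ - s β))), ⟨_, ?_, rfl⟩, ?_⟩
    · rw [hker]
      change G (θ - s β - R' (G (θ - s β))) = 0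
      rw [map_sub, hGR, sub_self]
    · rw [← map_sub, sub_sub_cancel]
      calc ‖A (R' (G (θ - s β)))‖ ≤ a * (‖R'‖ * ‖G (θ - s β)‖) :=
            (hA _).trans (by gcongr; exact R'.le_opNorm _)
        _ ≤ a * (‖R'‖ * (η / (a * ‖R'‖ * a' + 1) * (a' * ‖A (θ - s β)‖))) := by
            gcongr
            exact h1.trans (by gcongr)
        _ = η * (a * ‖R'‖ * a' / (a * ‖R'‖ * a' + 1)) * ‖A (θ - s β)‖ := by ring
        _ ≤ η * 1 * ‖A (θ - s β)‖ := by
            gcongr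
            exact (div_le_one (by positivity)).2 (by linarith)
        _ = _ := by ring

end Tangent

/-! ### Derivatives of families of functions -/

section Derivatives

variable {V F : Type*} [NormedAddCommGroup V] [NormedSpace ℝ V] [NormedAddCommGroup F]
  [NormedSpace ℝ F]

/-- In finite dimension L is a finite sum of fixed continuous linear images of its values on a
basis. -/
theorem ContinuousLinearMap.aestronglyMeasurable_of_apply [FiniteDimensional ℝ V] {𝒳 : Type*}
    [MeasurableSpace 𝒳] {ν : Measure 𝒳} {L : 𝒳 → V →L[ℝ] F}
    (hL : ∀ v, AEStronglyMeasurable (fun x => L x v) ν) : AEStronglyMeasurable L ν := by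
  set b := Module.finBasis ℝ V
  have : L = fun x => ∑ i, ContinuousLinearMap.smulRightL ℝ V F
      (LinearMap.toContinuousLinearMap (b.coord i)) (L x (b i)) := by
    funext x
    ext v
    conv_lhs => rw [← b.sum_repr v]
    simp only [map_sum, map_smul, FunLike.coe_sum, Finset.sum_apply,
      ContinuousLinearMap.smulRightL_apply_apply, ContinuousLinearMap.smulRight_apply]
    rfl
  rw [this]
  refine Finset.aestronglyMeasurable_fun_sum _ fun i _ => ?_
  exact (ContinuousLinearMap.continuous _).comp_aestronglyMeasurable (hL _)

/-- Each directional derivative is an a.e. limit of difference quotients along z₀ + v/n. The index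
is shifted by n₀ so that all these points lie where f is known to be measurable. -/
theorem aestronglyMeasurable_fderiv [FiniteDimensional ℝ V] {𝒳 : Type*} [MeasurableSpace 𝒳]
    {ν : Measure 𝒳} {f : V → 𝒳 → F} {z₀ : V}
    (hf : ∀ᶠ z in 𝓝 z₀, AEStronglyMeasurable (f z) ν)
    (hd : ∀ᵐ x ∂ν, DifferentiableAt ℝ (fun z => f z x) z₀) :
    AEStronglyMeasurable (fun x => fderiv ℝ (fun z => f z x) z₀) ν := by
  refine ContinuousLinearMap.aestronglyMeasurable_of_apply fun v => ?_
  have h0 : Tendsto (fun n : ℕ => z₀ + (n : ℝ)⁻¹ • v) atTop (𝓝 z₀) := by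
    have := (tendsto_inv_atTop_nhds_zero_nat (𝕜 := ℝ)).smul_const v
    simpa using this.const_add z₀
  obtain ⟨n₀, hn₀⟩ := eventually_atTop.1 (h0.eventually hf)
  refine aestronglyMeasurable_of_tendsto_ae atTop
    (f := fun (n : ℕ) x => ((n + n₀ : ℕ) : ℝ) • (f (z₀ + ((n + n₀ : ℕ) : ℝ)⁻¹ • v) x - f z₀ x))
    (fun n => ?_) ?_
  · exact ((hn₀ _ (by omega)).sub hf.self_of_nhds).const_smul _
  · filter_upwards [hd] with x hx
    refine hx.hasFDerivAt.lim v ?_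
    exact (tendsto_norm_atTop_atTop.comp tendsto_natCast_atTop_atTop).comp
      (tendsto_add_atTop_nat n₀)

set_option maxSynthPendingDepth 5 in
/-- Taylor's formula of order two, with a bound on the remainder. -/
theorem norm_sub_taylor_two_le {f : V → F} {z₀ z : V} {ρ C : ℝ}
    (hf : ContDiffOn ℝ 3 f (Metric.ball z₀ ρ))
    (hC : ∀ y ∈ Metric.ball z₀ ρ, ‖iteratedFDeriv ℝ 3 f y‖ ≤ C) (hz : z ∈ Metric.ball z₀ ρ) :
    ‖f z - f z₀ - fderiv ℝ f z₀ (z - z₀) -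
      (1 / 2 : ℝ) • fderiv ℝ (fderiv ℝ f) z₀ (z - z₀) (z - z₀)‖ ≤ C * ‖z - z₀‖ ^ 3 := by
  have hρ : 0 < ρ := Metric.pos_of_mem_ball hz
  have hz₀ : z₀ ∈ Metric.ball z₀ ρ := Metric.mem_ball_self hρ
  have ho : IsOpen (Metric.ball z₀ ρ) := Metric.isOpen_ball
  have h1 : ContDiffOn ℝ 2 (fderiv ℝ f) (Metric.ball z₀ ρ) :=
    hf.fderiv_of_isOpen ho (by norm_num)
  have h2 : ContDiffOn ℝ 1 (fderiv ℝ (fderiv ℝ f)) (Metric.ball z₀ ρ) :=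
    h1.fderiv_of_isOpen ho (by norm_num)
  have hC' : ∀ y ∈ Metric.ball z₀ ρ, ‖fderiv ℝ (fderiv ℝ (fderiv ℝ f)) y‖ ≤ C := fun y hy => by
    have := hC y hy
    rwa [← norm_iteratedFDeriv_fderiv, ← norm_iteratedFDeriv_fderiv, ← norm_iteratedFDeriv_fderiv,
      norm_iteratedFDeriv_zero] at this
  have hd1 : ∀ y ∈ Metric.ball z₀ ρ, DifferentiableAt ℝ f y := fun y hy =>
    (hf.contDiffAt (ho.mem_nhds hy)).differentiableAt (by norm_num)
  have hd2 : ∀ y ∈ Metric.ball z₀ ρ, DifferentiableAt ℝ (fderiv ℝ f) y := fun y hy =>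
    (h1.contDiffAt (ho.mem_nhds hy)).differentiableAt (by norm_num)
  have hd3 : ∀ y ∈ Metric.ball z₀ ρ, DifferentiableAt ℝ (fderiv ℝ (fderiv ℝ f)) y := fun y hy =>
    (h2.contDiffAt (ho.mem_nhds hy)).differentiableAt (by norm_num)
  have hC0 : 0 ≤ C := (norm_nonneg _).trans (hC z₀ hz₀)
  have hsub : segment ℝ z₀ z ⊆ Metric.ball z₀ ρ := (convex_ball z₀ ρ).segment_subset hz₀ hz
  have hnorm : ∀ y ∈ segment ℝ z₀ z, ‖y - z₀‖ ≤ ‖z - z₀‖ := fun y hy => by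
    have := (convex_closedBall z₀ ‖z - z₀‖).segment_subset
      (Metric.mem_closedBall_self (norm_nonneg _)) (by simp [dist_eq_norm]) hy
    simpa [dist_eq_norm] using this
  -- The mean value inequality is used for f'', then for f' minus its linear part, then for f minus
  -- its quadratic part. This gives the constant C instead of C/6, which is enough.
  have hl2 : ∀ y ∈ Metric.ball z₀ ρ,
      ‖fderiv ℝ (fderiv ℝ f) y - fderiv ℝ (fderiv ℝ f) z₀‖ ≤ C * ‖y - z₀‖ := fun y hy =>
    (convex_ball z₀ ρ).norm_image_sub_le_of_norm_fderiv_le hd3 hC' hz₀ hy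
  have hl1 : ∀ y ∈ segment ℝ z₀ z, ‖fderiv ℝ f y - fderiv ℝ f z₀ -
      fderiv ℝ (fderiv ℝ f) z₀ (y - z₀)‖ ≤ C * ‖z - z₀‖ * ‖z - z₀‖ := fun y hy => by
    have := (convex_segment z₀ z).norm_image_sub_le_of_norm_hasFDerivWithin_le'
      (φ := fderiv ℝ (fderiv ℝ f) z₀) (C := C * ‖z - z₀‖)
      (fun w hw => (hd2 w (hsub hw)).hasFDerivAt.hasFDerivWithinAt)
      (fun w hw => (hl2 w (hsub hw)).trans (by gcongr; exact hnorm w hw))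
      (left_mem_segment ℝ z₀ z) hy
    exact this.trans (by gcongr; exact hnorm y hy)
  -- Symmetry of f'' makes the derivative of half the quadratic form equal to f''(z₀)(y - z₀).
  have hsymm : IsSymmSndFDerivAt ℝ f z₀ :=
    (hf.contDiffAt (ho.mem_nhds hz₀)).isSymmSndFDerivAt (by simp; norm_num)
  have hq : ∀ y, HasFDerivAt (fun y => (1 / 2 : ℝ) • fderiv ℝ (fderiv ℝ f) z₀ (y - z₀) (y - z₀))
      (fderiv ℝ (fderiv ℝ f) z₀ (y - z₀)) y := fun y => by
    have e1 : HasFDerivAt (fun y => y - z₀) (ContinuousLinearMap.id ℝ V) y :=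
      (hasFDerivAt_id y).sub_const z₀
    have e2 := ((fderiv ℝ (fderiv ℝ f) z₀).hasFDerivAt (x := y - z₀)).comp y e1
    refine ((e2.clm_apply e1).const_smul (1 / 2 : ℝ)).congr_fderiv ?_
    ext v
    have hv : fderiv ℝ (fderiv ℝ f) z₀ (y - z₀) v = fderiv ℝ (fderiv ℝ f) z₀ v (y - z₀) :=
      hsymm _ _
    simp only [smul_apply, add_apply,
      ContinuousLinearMap.comp_apply, ContinuousLinearMap.flip_apply, ContinuousLinearMap.id_apply,
      Function.comp_apply, hv]
    rw [← two_smul ℝ, smul_smul]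
    norm_num
  have := (convex_segment z₀ z).norm_image_sub_le_of_norm_hasFDerivWithin_le'
      (f := fun y => f y - (1 / 2 : ℝ) • fderiv ℝ (fderiv ℝ f) z₀ (y - z₀) (y - z₀))
      (φ := fderiv ℝ f z₀) (C := C * ‖z - z₀‖ * ‖z - z₀‖)
      (fun w hw => ((hd1 w (hsub hw)).hasFDerivAt.sub (hq w)).hasFDerivWithinAt)
      (fun w hw => by rw [sub_right_comm]; exact hl1 w hw)
      (left_mem_segment ℝ z₀ z) (right_mem_segment ℝ z₀ z)
  convert this using 1
  · congr 1
    simp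
    abel
  · ring

end Derivatives

/-! ### Derivatives of divergence functions -/

namespace IsDivergenceFunction

variable {φ : ℝ → ℝ≥0∞}

theorem phiReal_one (h : IsDivergenceFunction φ) : phiReal φ 1 = 0 := by
  simp [phiReal, h.map_one]

theorem hasDerivAt_phiReal (h : IsDivergenceFunction φ) {u : ℝ} (hu : u ∈ interior (phiDom φ)) :
    HasDerivAt (phiReal φ) (phiDeriv φ u) u :=
  (h.differentiable.differentiableAt (isOpen_interior.mem_nhds hu)).hasDerivAt

/-- 1 is a minimum of φ. Since `toReal` sends ∞ to 0, the finite part is nonnegative on the whole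
line and no restriction to the domain is needed. -/
theorem phiDeriv_one (h : IsDivergenceFunction φ) : phiDeriv φ 1 = 0 := by
  refine IsLocalMin.deriv_eq_zero (Eventually.of_forall fun x => ?_)
  rw [h.phiReal_one]
  exact ENNReal.toReal_nonneg

theorem measurable_phiReal (h : IsDivergenceFunction φ) : Measurable (phiReal φ) :=
  h.closed.measurable.ennreal_toReal

end IsDivergenceFunction

theorem measurable_phiDeriv (φ : ℝ → ℝ≥0∞) : Measurable (phiDeriv φ) := measurable_deriv _

section PhiSmooth

variable {φ : ℝ → ℝ≥0∞}

theorem contDiffOn_phiDeriv (hφ : ContDiffOn ℝ 4 (phiReal φ) (interior (phiDom φ))) :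
    ContDiffOn ℝ 3 (phiDeriv φ) (interior (phiDom φ)) :=
  hφ.deriv_of_isOpen isOpen_interior (by norm_num)

theorem contDiffOn_phiDeriv2 (hφ : ContDiffOn ℝ 4 (phiReal φ) (interior (phiDom φ))) :
    ContDiffOn ℝ 2 (phiDeriv2 φ) (interior (phiDom φ)) :=
  (contDiffOn_phiDeriv hφ).deriv_of_isOpen isOpen_interior (by norm_num)

theorem hasDerivAt_phiDeriv (hφ : ContDiffOn ℝ 4 (phiReal φ) (interior (phiDom φ))) {u : ℝ}
    (hu : u ∈ interior (phiDom φ)) : HasDerivAt (phiDeriv φ) (phiDeriv2 φ u) u :=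
  (((contDiffOn_phiDeriv hφ).contDiffAt (isOpen_interior.mem_nhds hu)).differentiableAt
    (by norm_num)).hasDerivAt

/-- The second derivative at `0` of `φ'(u) u (R - p₀) + p₀ φ(u)`, where `u = P / R`. -/
theorem second_deriv_ratio_eq (h : IsDivergenceFunction φ)
    (hφ : ContDiffOn ℝ 4 (phiReal φ) (interior (phiDom φ))) {P R P₁ R₁ m₁ : ℝ → ℝ} {p₀ k : ℝ}
    (hp₀ : 0 < p₀) (hP0 : P 0 = p₀) (hR0 : R 0 = p₀) (hP : ∀ᶠ t in 𝓝 0, HasDerivAt P (P₁ t) t)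
    (hR : ∀ᶠ t in 𝓝 0, HasDerivAt R (R₁ t) t) (hP₁ : DifferentiableAt ℝ P₁ 0)
    (hR₁ : DifferentiableAt ℝ R₁ 0)
    (hm : ∀ᶠ t in 𝓝 0, HasDerivAt (fun t => phiDeriv φ (P t / R t) * (P t / R t) * (R t - p₀) +
      p₀ * phiReal φ (P t / R t)) (m₁ t) t) (hk : HasDerivAt m₁ k 0) :
    k = phiDeriv2 φ 1 / p₀ * (P₁ 0 ^ 2 - R₁ 0 ^ 2) := by
  have hcR : ContinuousAt R 0 := hR.self_of_nhds.continuousAt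
  have hcP : ContinuousAt P 0 := hP.self_of_nhds.continuousAt
  have hR0' : R 0 ≠ 0 := by rw [hR0]; exact hp₀.ne'
  have hu0 : P 0 / R 0 = 1 := by rw [hP0, hR0, div_self hp₀.ne']
  have hRne : ∀ᶠ t in 𝓝 0, R t ≠ 0 := hcR.eventually_ne hR0'
  have hmem : ∀ᶠ t in 𝓝 0, P t / R t ∈ interior (phiDom φ) :=
    (hcP.div hcR hR0').eventually_mem (isOpen_interior.mem_nhds (by
      rw [Pi.div_apply, hu0]; exact h.one_mem))
  set u : ℝ → ℝ := fun t => P t / R t with hudef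
  set u₁ : ℝ → ℝ := fun t => (P₁ t * R t - P t * R₁ t) / R t ^ 2 with hu₁def
  have hu : ∀ᶠ t in 𝓝 0, HasDerivAt u (u₁ t) t := by
    filter_upwards [hP, hR, hRne] with t h1 h2 h3
    exact h1.div h2 h3
  set ψ₁ : ℝ → ℝ := fun t =>
    phiDeriv2 φ (u t) * u₁ t * u t + phiDeriv φ (u t) * u₁ t with hψ₁
  have hψ : ∀ᶠ t in 𝓝 0, HasDerivAt (fun t => phiDeriv φ (u t) * u t) (ψ₁ t) t := by
    filter_upwards [hu, hmem] with t h1 h2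
    exact ((hasDerivAt_phiDeriv hφ h2).comp t h1).mul h1
  have hφu : ∀ᶠ t in 𝓝 0, HasDerivAt (fun t => phiReal φ (u t)) (phiDeriv φ (u t) * u₁ t) t := by
    filter_upwards [hu, hmem] with t h1 h2
    exact (h.hasDerivAt_phiReal h2).comp t h1
  have hm' : m₁ =ᶠ[𝓝 0] fun t => ψ₁ t * (R t - p₀) + phiDeriv φ (u t) * u t * R₁ t +
      p₀ * (phiDeriv φ (u t) * u₁ t) := by
    filter_upwards [hm, hψ, hφu, hR] with t h1 h2 h3 h4
    exact h1.unique ((h2.mul (h4.sub_const p₀)).add (h3.const_mul p₀))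
  have hu00 : u 0 = 1 := hu0
  have hR1 := hR.self_of_nhds
  have hP1 := hP.self_of_nhds
  have hud := hu.self_of_nhds
  have hu₁d : DifferentiableAt ℝ u₁ 0 :=
    ((hP₁.mul hR1.differentiableAt).sub (hP1.differentiableAt.mul hR₁)).div
      (hR1.differentiableAt.pow 2) (pow_ne_zero 2 hR0')
  have hφ1d : HasDerivAt (fun t => phiDeriv φ (u t)) (phiDeriv2 φ 1 * u₁ 0) 0 := by
    have := (hasDerivAt_phiDeriv hφ hmem.self_of_nhds).comp 0 hud
    rwa [hu0] at this
  have hφ2d : DifferentiableAt ℝ (fun t => phiDeriv2 φ (u t)) 0 := by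
    refine DifferentiableAt.comp (g := phiDeriv2 φ) 0 ?_ hud.differentiableAt
    exact ((contDiffOn_phiDeriv2 hφ).contDiffAt
      (isOpen_interior.mem_nhds hmem.self_of_nhds)).differentiableAt (by norm_num)
  have hψ₁d : DifferentiableAt ℝ ψ₁ 0 :=
    ((hφ2d.mul hu₁d).mul hud.differentiableAt).add (hφ1d.differentiableAt.mul hu₁d)
  have hk' := hk.congr_of_eventuallyEq hm'.symm
  -- At t = 0 the factors R - p₀ and φ'(u) vanish, which removes every second derivative of P and R.
  -- With u' = (P₁ - R₁)/p₀, what remains is φ''(1) u' (2R₁ + p₀ u') = φ''(1) u' (P₁ + R₁).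
  have := hk'.unique (((hψ₁d.hasDerivAt.mul (hR1.sub_const p₀)).add
    ((hφ1d.mul hud).mul hR₁.hasDerivAt)).add ((hφ1d.mul hu₁d.hasDerivAt).const_mul p₀))
  rw [this]
  simp only [Pi.mul_apply, hψ₁, hu00, h.phiDeriv_one, hR0, hP0, hu₁def]
  field_simp
  ring

end PhiSmooth

/-! ### Derivatives of functions of the ratio of two densities -/

section Ratio

variable {E : Type*} [NormedAddCommGroup E] [NormedSpace ℝ E] {φ : ℝ → ℝ≥0∞} {p : E → ℝ}
  {N : Set E}

theorem contDiffOn_ratio (hp : ContDiffOn ℝ 3 p N) (hpos : ∀ θ ∈ N, 0 < p θ) :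
    ContDiffOn ℝ 3 (fun z : E × E => p z.1 / p z.2) (N ×ˢ N) :=
  (hp.comp contDiffOn_fst fun _ hz => hz.1).div (hp.comp contDiffOn_snd fun _ hz => hz.2)
    fun z hz => (hpos z.2 hz.2).ne'

theorem contDiffOn_fp (hφ : ContDiffOn ℝ 4 (phiReal φ) (interior (phiDom φ)))
    (hp : ContDiffOn ℝ 3 p N) (hpos : ∀ θ ∈ N, 0 < p θ)
    (hmem : ∀ θ ∈ N, ∀ α ∈ N, p θ / p α ∈ interior (phiDom φ)) :
    ContDiffOn ℝ 3 (fun z : E × E => phiDeriv φ (p z.1 / p z.2) * p z.1) (N ×ˢ N) :=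
  ((contDiffOn_phiDeriv hφ).comp (contDiffOn_ratio hp hpos) fun _ hz => hmem _ hz.1 _ hz.2).mul
    (hp.comp contDiffOn_fst fun _ hz => hz.1)

theorem contDiffOn_g (hφ : ContDiffOn ℝ 4 (phiReal φ) (interior (phiDom φ)))
    (hp : ContDiffOn ℝ 3 p N) (hpos : ∀ θ ∈ N, 0 < p θ)
    (hmem : ∀ θ ∈ N, ∀ α ∈ N, p θ / p α ∈ interior (phiDom φ)) :
    ContDiffOn ℝ 3 (fun z : E × E => p z.1 / p z.2 * phiDeriv φ (p z.1 / p z.2) -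
      phiReal φ (p z.1 / p z.2)) (N ×ˢ N) :=
  ((contDiffOn_ratio hp hpos).mul ((contDiffOn_phiDeriv hφ).comp (contDiffOn_ratio hp hpos)
    fun _ hz => hmem _ hz.1 _ hz.2)).sub ((hφ.of_le (by norm_num)).comp (contDiffOn_ratio hp hpos)
    fun _ hz => hmem _ hz.1 _ hz.2)

variable {θ : E} {p' : E →L[ℝ] ℝ}

theorem hasFDerivAt_ratio_diag (hp : HasFDerivAt p p' θ) (hpos : 0 < p θ) :
    HasFDerivAt (fun z : E × E => p z.1 / p z.2)
      ((p θ)⁻¹ • (p'.comp (ContinuousLinearMap.fst ℝ E E) -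
        p'.comp (ContinuousLinearMap.snd ℝ E E))) (θ, θ) := by
  have h1 : HasFDerivAt (fun z : E × E => p z.1) (p'.comp (ContinuousLinearMap.fst ℝ E E)) (θ, θ) :=
    HasFDerivAt.comp (g := p) (θ, θ) hp hasFDerivAt_fst
  have h2 : HasFDerivAt (fun z : E × E => p z.2) (p'.comp (ContinuousLinearMap.snd ℝ E E)) (θ, θ) :=
    HasFDerivAt.comp (g := p) (θ, θ) hp hasFDerivAt_snd
  simp only [div_eq_mul_inv]
  refine (h1.mul ((hasDerivAt_inv hpos.ne').comp_hasFDerivAt (θ, θ) h2)).congr_fderiv ?_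
  ext w <;> simp <;> field_simp

theorem hasFDerivAt_fp_diag (h : IsDivergenceFunction φ)
    (hφ : ContDiffOn ℝ 4 (phiReal φ) (interior (phiDom φ))) (hp : HasFDerivAt p p' θ)
    (hpos : 0 < p θ) :
    HasFDerivAt (fun z : E × E => phiDeriv φ (p z.1 / p z.2) * p z.1)
      (phiDeriv2 φ 1 • (p'.comp (ContinuousLinearMap.fst ℝ E E) -
        p'.comp (ContinuousLinearMap.snd ℝ E E))) (θ, θ) := by
  have hu := hasFDerivAt_ratio_diag hp hpos
  have h1 : HasFDerivAt (fun z : E × E => p z.1) (p'.comp (ContinuousLinearMap.fst ℝ E E)) (θ, θ) :=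
    HasFDerivAt.comp (g := p) (θ, θ) hp hasFDerivAt_fst
  have h0 : deriv (phiReal φ) 1 = 0 := h.phiDeriv_one
  have hd : HasDerivAt (phiDeriv φ) (phiDeriv2 φ 1) (p θ / p θ) := by
    rw [div_self hpos.ne']; exact hasDerivAt_phiDeriv hφ h.one_mem
  refine ((hd.comp_hasFDerivAt (θ, θ) hu).mul h1).congr_fderiv ?_
  ext w <;> simp [div_self hpos.ne', h0] <;> field_simp

theorem hasFDerivAt_g_diag (h : IsDivergenceFunction φ)
    (hφ : ContDiffOn ℝ 4 (phiReal φ) (interior (phiDom φ))) (hp : HasFDerivAt p p' θ)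
    (hpos : 0 < p θ) :
    HasFDerivAt (fun z : E × E => p z.1 / p z.2 * phiDeriv φ (p z.1 / p z.2) -
      phiReal φ (p z.1 / p z.2))
      ((phiDeriv2 φ 1 / p θ) • (p'.comp (ContinuousLinearMap.fst ℝ E E) -
        p'.comp (ContinuousLinearMap.snd ℝ E E))) (θ, θ) := by
  have hu := hasFDerivAt_ratio_diag hp hpos
  have hd : HasDerivAt (phiDeriv φ) (phiDeriv2 φ 1) (p θ / p θ) := by
    rw [div_self hpos.ne']; exact hasDerivAt_phiDeriv hφ h.one_mem
  have hd0 : HasDerivAt (phiReal φ) (phiDeriv φ 1) (p θ / p θ) := by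
    rw [div_self hpos.ne']; exact h.hasDerivAt_phiReal h.one_mem
  refine ((hu.mul (hd.comp_hasFDerivAt (θ, θ) hu)).sub
    (hd0.comp_hasFDerivAt (θ, θ) hu)).congr_fderiv ?_
  ext w <;> simp [div_self hpos.ne'] <;> field_simp

/-- The second derivative of `f p - p_θ g` on the diagonal. -/
theorem second_fderiv_fp_sub_g (h : IsDivergenceFunction φ)
    (hφ : ContDiffOn ℝ 4 (phiReal φ) (interior (phiDom φ))) (hN : IsOpen N)
    (hp : ContDiffOn ℝ 3 p N) (hpos : ∀ θ ∈ N, 0 < p θ)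
    (hmem : ∀ θ ∈ N, ∀ α ∈ N, p θ / p α ∈ interior (phiDom φ)) (hθ : θ ∈ N) (w : E × E) :
    fderiv ℝ (fderiv ℝ fun z : E × E => phiDeriv φ (p z.1 / p z.2) * p z.1) (θ, θ) w w -
      p θ * fderiv ℝ (fderiv ℝ fun z : E × E => p z.1 / p z.2 * phiDeriv φ (p z.1 / p z.2) -
        phiReal φ (p z.1 / p z.2)) (θ, θ) w w =
      phiDeriv2 φ 1 / p θ * (fderiv ℝ p θ w.1 ^ 2 - fderiv ℝ p θ w.2 ^ 2) := by
  set F : E × E → ℝ := fun z => phiDeriv φ (p z.1 / p z.2) * p z.1 with hF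
  set G : E × E → ℝ := fun z => p z.1 / p z.2 * phiDeriv φ (p z.1 / p z.2) -
        phiReal φ (p z.1 / p z.2) with hG
  have hNN : IsOpen (N ×ˢ N) := hN.prod hN
  have hFc : ContDiffOn ℝ 3 F (N ×ˢ N) := contDiffOn_fp hφ hp hpos hmem
  have hGc : ContDiffOn ℝ 3 G (N ×ˢ N) := contDiffOn_g hφ hp hpos hmem
  have hz : ((θ, θ) : E × E) ∈ N ×ˢ N := ⟨hθ, hθ⟩
  have hline : ∀ {V : Type _} [NormedAddCommGroup V] [NormedSpace ℝ V] (y v : V) (t : ℝ),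
      HasDerivAt (fun t : ℝ => y + t • v) v t := fun y v t => by
    simpa using ((hasDerivAt_id t).smul_const v).const_add y
  have hcont : ∀ {V : Type _} [NormedAddCommGroup V] [NormedSpace ℝ V] (y v : V) (s : Set V),
      IsOpen s → y ∈ s → ∀ᶠ t : ℝ in 𝓝 0, y + t • v ∈ s := fun y v s hs hy => by
    refine (hline y v 0).continuousAt.eventually_mem (hs.mem_nhds ?_)
    simpa using hy
  have hfirst : ∀ {V : Type _} [NormedAddCommGroup V] [NormedSpace ℝ V] {f : V → ℝ} {s : Set V}
      (y v : V), IsOpen s → y ∈ s → ContDiffOn ℝ 3 f s →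
      ∀ᶠ t : ℝ in 𝓝 0, HasDerivAt (fun t : ℝ => f (y + t • v)) (fderiv ℝ f (y + t • v) v) t := by
    intro V _ _ f s y v hs hy hf
    filter_upwards [hcont y v s hs hy] with t ht
    exact ((hf.contDiffAt (hs.mem_nhds ht)).differentiableAt
      (by norm_num)).hasFDerivAt.comp_hasDerivAt t (hline y v t)
  have hsecond : ∀ {V : Type _} [NormedAddCommGroup V] [NormedSpace ℝ V] {f : V → ℝ} {s : Set V}
      (y v : V), IsOpen s → y ∈ s → ContDiffOn ℝ 3 f s →
      HasDerivAt (fun t : ℝ => fderiv ℝ f (y + t • v) v) (fderiv ℝ (fderiv ℝ f) y v v) 0 := by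
    intro V _ _ f s y v hs hy hf
    have h1 : HasFDerivAt (fderiv ℝ f) (fderiv ℝ (fderiv ℝ f) y) (y + (0 : ℝ) • v) := by
      rw [zero_smul, add_zero]
      exact (((hf.fderiv_of_isOpen (m := 2) hs (by norm_num)).contDiffAt
        (hs.mem_nhds hy)).differentiableAt (by norm_num)).hasFDerivAt
    have h2 := h1.comp_hasDerivAt (0 : ℝ) (hline y v 0)
    simpa using h2.clm_apply (hasDerivAt_const (0 : ℝ) v)
  -- Both sides are restricted to the line (θ, θ) + t w. With u = P/R one has φ'(u)P - p₀(uφ'(u) -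
  -- φ(u)) = φ'(u)u(R - p₀) + p₀φ(u), the one-variable function treated above.
  have hk := (hsecond (θ, θ) w hNN hz hFc).sub ((hsecond (θ, θ) w hNN hz hGc).const_mul (p θ))
  have key := second_deriv_ratio_eq h hφ (P := fun t => p (θ + t • w.1))
    (R := fun t => p (θ + t • w.2)) (hpos θ hθ) (by simp) (by simp)
    (hfirst θ w.1 hN hθ hp) (hfirst θ w.2 hN hθ hp) (hsecond θ w.1 hN hθ hp).differentiableAt
    (hsecond θ w.2 hN hθ hp).differentiableAt ?_ hk
  · simpa using key
  · filter_upwards [hfirst (θ, θ) w hNN hz hFc, hfirst (θ, θ) w hNN hz hGc,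
      (hcont θ w.2 N hN hθ).eventually_nhds] with t h1 h2 h3
    refine (h1.sub (h2.const_mul (p θ))).congr_of_eventuallyEq ?_
    filter_upwards [h3] with t ht
    have := (hpos _ ht).ne'
    simp only [hF, hG, Prod.fst_add, Prod.smul_fst, Prod.snd_add, Prod.smul_snd, Pi.sub_apply]
    field_simp
    ring

end Ratio

/-! ### Integration with respect to the distributions of a model -/

namespace ParametricModel

variable {d : ℕ} {𝒳 : Type*} [MeasurableSpace 𝒳] {M : ParametricModel d 𝒳} {φ : ℝ → ℝ≥0∞}
  {θ α : EuclideanSpace ℝ (Fin d)}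

theorem isProbabilityMeasure_P (hθ : θ ∈ M.Θ) : IsProbabilityMeasure (M.P θ) :=
  ⟨by rw [P, withDensity_apply _ MeasurableSet.univ, Measure.restrict_univ, M.lintegral_p θ hθ]⟩

theorem ae_P_iff (hθ : θ ∈ M.Θ) {q : 𝒳 → Prop} :
    (∀ᵐ x ∂M.P θ, q x) ↔ ∀ᵐ x ∂M.ref, 0 < M.p θ x → q x := by
  rw [P, ae_withDensity_iff (M.measurable_p θ hθ).ennreal_ofReal]
  simp

theorem P_absolutelyContinuous (θ : EuclideanSpace ℝ (Fin d)) : M.P θ ≪ M.ref :=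
  withDensity_absolutelyContinuous _ _

theorem integral_P (hθ : θ ∈ M.Θ) {F : Type*} [NormedAddCommGroup F] [NormedSpace ℝ F]
    (f : 𝒳 → F) : ∫ x, f x ∂M.P θ = ∫ x, M.p θ x • f x ∂M.ref := by
  rw [P, integral_withDensity_eq_integral_toReal_smul (M.measurable_p θ hθ).ennreal_ofReal
    (by simp)]
  simp [ENNReal.toReal_ofReal (M.p_nonneg θ hθ _)]

theorem integrable_P_iff (hθ : θ ∈ M.Θ) {F : Type*} [NormedAddCommGroup F] [NormedSpace ℝ F]
    {f : 𝒳 → F} : Integrable f (M.P θ) ↔ Integrable (fun x => M.p θ x • f x) M.ref := by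
  rw [P, integrable_withDensity_iff_integrable_smul' (M.measurable_p θ hθ).ennreal_ofReal
    (by simp)]
  simp [ENNReal.toReal_ofReal (M.p_nonneg θ hθ _)]

theorem integrable_p (hθ : θ ∈ M.Θ) : Integrable (M.p θ) M.ref := by
  have := isProbabilityMeasure_P hθ
  simpa using (integrable_P_iff hθ).1 (integrable_const (1 : ℝ))

theorem integral_p (hθ : θ ∈ M.Θ) : ∫ x, M.p θ x ∂M.ref = 1 := by
  have := isProbabilityMeasure_P hθ
  simpa using (integral_P hθ (fun _ => (1 : ℝ))).symm

/-- Pointwise calculus takes place on the second alternative only. On the first all densities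
vanish, so `fp` is identically zero on Θ × Θ whatever value division by zero gives to the ratio. -/
theorem ae_support (hint : M.IntegrabilityCondition φ) (hθ : θ ∈ M.Θ) :
    ∀ᵐ x ∂M.ref, (∀ α ∈ M.Θ, M.p α x = 0) ∨ ((∀ α ∈ M.Θ, 0 < M.p α x) ∧
      ∀ α ∈ M.Θ, ∀ β ∈ M.Θ, M.p α x / M.p β x ∈ interior (phiDom φ)) := by
  filter_upwards [M.common_support, hint.ratio_mem] with x h1 h2
  rcases (M.p_nonneg θ hθ x).eq_or_lt' with h | h
  · refine Or.inl fun α hα => ((M.p_nonneg α hα x).eq_or_lt').resolve_right fun h3 => ?_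
    exact ((h1 α hα θ hθ).1 h3).ne' h
  · have h3 : ∀ α ∈ M.Θ, 0 < M.p α x := fun α hα => (h1 θ hθ α hα).1 h
    exact Or.inr ⟨h3, fun α hα β hβ => h2 α hα β hβ (h3 β hβ)⟩

theorem measurable_h (hφ : IsDivergenceFunction φ) (hθ : θ ∈ M.Θ) (hα : α ∈ M.Θ) :
    Measurable (M.h φ θ α) := by
  have h1 := (M.measurable_p θ hθ).div (M.measurable_p α hα)
  exact ((h1.mul ((measurable_phiDeriv φ).comp h1)).sub
    (hφ.measurable_phiReal.comp h1)).const_sub _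

/-- The product `f(θ, α, x) p_θ(x)`. -/
def fp (M : ParametricModel d 𝒳) (φ : ℝ → ℝ≥0∞)
    (z : EuclideanSpace ℝ (Fin d) × EuclideanSpace ℝ (Fin d)) (x : 𝒳) : ℝ :=
  M.f φ z.1 z.2 x * M.p z.1 x

theorem integral_f_eq (hθ : θ ∈ M.Θ) (α : EuclideanSpace ℝ (Fin d)) :
    ∫ y, M.f φ θ α y ∂M.P θ = ∫ y, M.fp φ (θ, α) y ∂M.ref := by
  rw [integral_P hθ]
  simp [fp, mul_comm]

theorem integrable_fp (hint : M.IntegrabilityCondition φ) (hθ : θ ∈ M.Θ) (hα : α ∈ M.Θ) :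
    Integrable (M.fp φ (θ, α)) M.ref := by
  have := (integrable_P_iff hθ).1 (hint.integrable θ hθ α hα)
  exact this.congr (ae_of_all _ fun x => by simp [fp, mul_comm])

theorem h_self (hφ : IsDivergenceFunction φ) (hθ : θ ∈ M.Θ) : ∀ᵐ x ∂M.P θ, M.h φ θ θ x = 0 := by
  have h0 : ∀ᵐ x ∂M.P θ, 0 < M.p θ x := (ae_P_iff hθ).2 (ae_of_all _ fun _ h => h)
  have h1 : ∫ y, M.f φ θ θ y ∂M.P θ = 0 := by
    refine integral_eq_zero_of_ae ?_
    filter_upwards [h0] with x hx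
    simp [f, div_self hx.ne', hφ.phiDeriv_one]
  filter_upwards [h0] with x hx
  rw [h, h1, g, div_self hx.ne', hφ.phiDeriv_one, hφ.phiReal_one]
  simp

variable {θT : EuclideanSpace ℝ (Fin d)} {N : Set (EuclideanSpace ℝ (Fin d))}

theorem ae_contDiffOn_fp (hφ4 : ContDiffOn ℝ 4 (phiReal φ) (interior (phiDom φ)))
    (hint : M.IntegrabilityCondition φ) (hθN : θT ∈ N) (hNΘ : N ⊆ M.Θ)
    (hp : ∀ᵐ x ∂M.ref, ContDiffOn ℝ 3 (fun θ => M.p θ x) N) :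
    ∀ᵐ x ∂M.ref, ContDiffOn ℝ 3 (fun z => M.fp φ z x) (N ×ˢ N) := by
  filter_upwards [ae_support hint (hNΘ hθN), hp] with x hx hpx
  rcases hx with hx | ⟨hx, hr⟩
  · refine (contDiffOn_const (c := (0 : ℝ))).congr fun z hz => ?_
    simp [fp, hx z.1 (hNΘ hz.1)]
  · exact contDiffOn_fp hφ4 hpx (fun θ hθ => hx θ (hNΘ hθ))
      fun θ hθ α hα => hr θ (hNΘ hθ) α (hNΘ hα)

theorem ae_contDiffOn_g (hφ4 : ContDiffOn ℝ 4 (phiReal φ) (interior (phiDom φ)))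
    (hint : M.IntegrabilityCondition φ) (hθN : θT ∈ N) (hNΘ : N ⊆ M.Θ)
    (hp : ∀ᵐ x ∂M.ref, ContDiffOn ℝ 3 (fun θ => M.p θ x) N) :
    ∀ᵐ x ∂M.P θT, ContDiffOn ℝ 3 (fun z : EuclideanSpace ℝ (Fin d) × EuclideanSpace ℝ (Fin d) =>
      M.g φ z.1 z.2 x) (N ×ˢ N) := by
  rw [ae_P_iff (hNΘ hθN)]
  filter_upwards [ae_support hint (hNΘ hθN), hp] with x hx hpx h0
  rcases hx with hx | ⟨hx, hr⟩
  · exact absurd (hx θT (hNΘ hθN)) h0.ne'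
  · exact contDiffOn_g hφ4 hpx (fun θ hθ => hx θ (hNΘ hθ))
      fun θ hθ α hα => hr θ (hNΘ hθ) α (hNΘ hα)

theorem DominationCondition.exists_bound (hdom : M.DominationCondition φ θT N) :
    ∃ G : 𝒳 → ℝ, Integrable G M.ref ∧ ∀ᵐ x ∂M.ref, ∀ z ∈ N ×ˢ N,
      ‖fderiv ℝ (fun z => M.fp φ z x) z‖ ≤ G x ∧
      ‖fderiv ℝ (fderiv ℝ fun z => M.fp φ z x) z‖ ≤ G x := by
  obtain ⟨G, hG, hb⟩ := hdom.dom_fp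
  refine ⟨G, hG, ?_⟩
  filter_upwards [hb] with x hx z hz
  obtain ⟨h1, h2⟩ := hx z hz
  rw [← norm_iteratedFDeriv_fderiv, norm_iteratedFDeriv_zero] at h1
  rw [← norm_iteratedFDeriv_fderiv, ← norm_iteratedFDeriv_fderiv, norm_iteratedFDeriv_zero] at h2
  exact ⟨h1, h2⟩

/-- Differentiation under the integral sign of `P_θ f(θ, α)`. -/
theorem hasFDerivAt_integral_fp (hφ4 : ContDiffOn ℝ 4 (phiReal φ) (interior (phiDom φ)))
    (hint : M.IntegrabilityCondition φ) (hN : IsOpen N) (hθN : θT ∈ N) (hNΘ : N ⊆ M.Θ)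
    (hp : ∀ᵐ x ∂M.ref, ContDiffOn ℝ 3 (fun θ => M.p θ x) N)
    (hdom : M.DominationCondition φ θT N)
    {z : EuclideanSpace ℝ (Fin d) × EuclideanSpace ℝ (Fin d)} (hz : z ∈ N ×ˢ N) :
    AEStronglyMeasurable (fun x => fderiv ℝ (fun z => M.fp φ z x) z) M.ref ∧
    Integrable (fun x => fderiv ℝ (fun z => M.fp φ z x) z) M.ref ∧
    HasFDerivAt (fun z => ∫ x, M.fp φ z x ∂M.ref)
      (∫ x, fderiv ℝ (fun z => M.fp φ z x) z ∂M.ref) z := by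
  obtain ⟨G, hG, hb⟩ := hdom.exists_bound
  have hNN : IsOpen (N ×ˢ N) := hN.prod hN
  have hsm := ae_contDiffOn_fp hφ4 hint hθN hNΘ hp
  have hd : ∀ᵐ x ∂M.ref, ∀ z ∈ N ×ˢ N, DifferentiableAt ℝ (fun z => M.fp φ z x) z := by
    filter_upwards [hsm] with x hx z hz
    exact (hx.contDiffAt (hNN.mem_nhds hz)).differentiableAt (by norm_num)
  have hmeas : ∀ z ∈ N ×ˢ N, AEStronglyMeasurable (M.fp φ z) M.ref := fun z hz =>
    (integrable_fp hint (hNΘ hz.1) (hNΘ hz.2)).aestronglyMeasurable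
  have hev : ∀ᶠ y in 𝓝 z, AEStronglyMeasurable (M.fp φ y) M.ref := by
    filter_upwards [hNN.mem_nhds hz] with y hy using hmeas y hy
  have h1 : AEStronglyMeasurable (fun x => fderiv ℝ (fun z => M.fp φ z x) z) M.ref :=
    aestronglyMeasurable_fderiv hev (hd.mono fun x hx => hx z hz)
  refine ⟨h1, hG.mono' h1 (hb.mono fun x hx => (hx z hz).1), ?_⟩
  exact hasFDerivAt_integral_of_dominated_of_fderiv_le (hNN.mem_nhds hz) hev
    (integrable_fp hint (hNΘ hz.1) (hNΘ hz.2)) h1 (hb.mono fun x hx y hy => (hx y hy).1) hG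
    (hd.mono fun x hx y hy => (hx y hy).hasFDerivAt)

set_option maxSynthPendingDepth 5 in
theorem hasFDerivAt_fderiv_integral_fp
    (hφ4 : ContDiffOn ℝ 4 (phiReal φ) (interior (phiDom φ)))
    (hint : M.IntegrabilityCondition φ) (hN : IsOpen N) (hθN : θT ∈ N) (hNΘ : N ⊆ M.Θ)
    (hp : ∀ᵐ x ∂M.ref, ContDiffOn ℝ 3 (fun θ => M.p θ x) N)
    (hdom : M.DominationCondition φ θT N)
    {z : EuclideanSpace ℝ (Fin d) × EuclideanSpace ℝ (Fin d)} (hz : z ∈ N ×ˢ N) :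
    Integrable (fun x => fderiv ℝ (fderiv ℝ fun z => M.fp φ z x) z) M.ref ∧
    HasFDerivAt (fderiv ℝ fun z => ∫ x, M.fp φ z x ∂M.ref)
      (∫ x, fderiv ℝ (fderiv ℝ fun z => M.fp φ z x) z ∂M.ref) z := by
  obtain ⟨G, hG, hb⟩ := hdom.exists_bound
  have hNN : IsOpen (N ×ˢ N) := hN.prod hN
  have hsm := ae_contDiffOn_fp hφ4 hint hθN hNΘ hp
  have hfirst := fun y hy => hasFDerivAt_integral_fp hφ4 hint hN hθN hNΘ hp hdom (z := y) hy
  have hd : ∀ᵐ x ∂M.ref, ∀ z ∈ N ×ˢ N, DifferentiableAt ℝ (fderiv ℝ fun z => M.fp φ z x) z := by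
    filter_upwards [hsm] with x hx z hz
    exact ((hx.fderiv_of_isOpen (m := 2) hNN (by norm_num)).contDiffAt
      (hNN.mem_nhds hz)).differentiableAt (by norm_num)
  have hev : ∀ᶠ y in 𝓝 z,
      AEStronglyMeasurable (fun x => fderiv ℝ (fun z => M.fp φ z x) y) M.ref := by
    filter_upwards [hNN.mem_nhds hz] with y hy using (hfirst y hy).1
  have h1 : AEStronglyMeasurable (fun x => fderiv ℝ (fderiv ℝ fun z => M.fp φ z x) z) M.ref :=
    aestronglyMeasurable_fderiv hev (hd.mono fun x hx => hx z hz)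
  refine ⟨hG.mono' h1 (hb.mono fun x hx => (hx z hz).2), ?_⟩
  have h2 := hasFDerivAt_integral_of_dominated_of_fderiv_le (hNN.mem_nhds hz) hev
    (hfirst z hz).2.1 h1 (hb.mono fun x hx y hy => (hx y hy).2) hG
    (hd.mono fun x hx y hy => (hx y hy).hasFDerivAt)
  refine h2.congr_of_eventuallyEq ?_
  filter_upwards [hNN.mem_nhds hz] with y hy using (hfirst y hy).2.2.fderiv

end ParametricModel

/-! ### The score and the derivatives of `h` at the true parameter -/

namespace ParametricModel

variable {d : ℕ} {𝒳 : Type*} [MeasurableSpace 𝒳] {M : ParametricModel d 𝒳} {φ : ℝ → ℝ≥0∞}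

/-- The score `p'_θ / p_θ`. -/
def score (M : ParametricModel d 𝒳) (θ : EuclideanSpace ℝ (Fin d)) (x : 𝒳) :
    EuclideanSpace ℝ (Fin d) →L[ℝ] ℝ :=
  (M.p θ x)⁻¹ • fderiv ℝ (fun t => M.p t x) θ

variable {θT : EuclideanSpace ℝ (Fin d)} {N : Set (EuclideanSpace ℝ (Fin d))}

theorem aestronglyMeasurable_fderiv_p (hN : IsOpen N) (hθN : θT ∈ N) (hNΘ : N ⊆ M.Θ)
    (hp : ∀ᵐ x ∂M.ref, ContDiffOn ℝ 3 (fun θ => M.p θ x) N) :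
    AEStronglyMeasurable (fun x => fderiv ℝ (fun t => M.p t x) θT) M.ref := by
  refine aestronglyMeasurable_fderiv (f := M.p) ?_ ?_
  · filter_upwards [hN.mem_nhds hθN] with θ hθ
    exact (M.measurable_p θ (hNΘ hθ)).aestronglyMeasurable
  · filter_upwards [hp] with x hx
    exact (hx.contDiffAt (hN.mem_nhds hθN)).differentiableAt (by norm_num)

theorem aestronglyMeasurable_score (hN : IsOpen N) (hθN : θT ∈ N) (hNΘ : N ⊆ M.Θ)
    (hp : ∀ᵐ x ∂M.ref, ContDiffOn ℝ 3 (fun θ => M.p θ x) N) :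
    AEStronglyMeasurable (M.score θT) (M.P θT) :=
  ((M.measurable_p θT (hNΘ hθN)).inv.aestronglyMeasurable.smul
    (aestronglyMeasurable_fderiv_p hN hθN hNΘ hp)).mono_ac (P_absolutelyContinuous θT)

theorem ae_fderiv_p_eq_zero (hint : M.IntegrabilityCondition φ) (hN : IsOpen N) (hθN : θT ∈ N)
    (hNΘ : N ⊆ M.Θ) :
    ∀ᵐ x ∂M.ref, ∀ θ ∈ N, M.p θ x = 0 → fderiv ℝ (fun t => M.p t x) θ = 0 := by
  filter_upwards [ae_support hint (hNΘ hθN)] with x hx θ hθ h0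
  rcases hx with hx | ⟨hx, -⟩
  · have : (fun t => M.p t x) =ᶠ[𝓝 θ] fun _ => 0 := by
      filter_upwards [hN.mem_nhds hθ] with t ht using hx t (hNΘ ht)
    rw [this.fderiv_eq]
    simp
  · exact absurd h0 (hx θ (hNΘ hθ)).ne'

/-- The derivative of the density integrates to zero. -/
theorem integral_fderiv_p (hφ : IsDivergenceFunction φ)
    (hφ4 : ContDiffOn ℝ 4 (phiReal φ) (interior (phiDom φ))) (hφ2 : 0 < phiDeriv2 φ 1)
    (hint : M.IntegrabilityCondition φ) (hN : IsOpen N) (hθN : θT ∈ N) (hNΘ : N ⊆ M.Θ)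
    (hp : ∀ᵐ x ∂M.ref, ContDiffOn ℝ 3 (fun θ => M.p θ x) N)
    (hdom : M.DominationCondition φ θT N) :
    Integrable (fun x => fderiv ℝ (fun t => M.p t x) θT) M.ref ∧
      ∫ x, fderiv ℝ (fun t => M.p t x) θT ∂M.ref = 0 := by
  obtain ⟨G, hG, hb⟩ := hdom.exists_bound
  have hd : ∀ᵐ x ∂M.ref, ∀ θ ∈ N, DifferentiableAt ℝ (fun t => M.p t x) θ := by
    filter_upwards [hp] with x hx θ hθ
    exact (hx.contDiffAt (hN.mem_nhds hθ)).differentiableAt (by norm_num)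
  -- No domination of p' is assumed. It follows from that of `fp`, whose derivative at (θ, θ) in the
  -- direction (v, 0) is φ''(1) p'_θ(v).
  have hbound : ∀ᵐ x ∂M.ref, ∀ θ ∈ N,
      ‖fderiv ℝ (fun t => M.p t x) θ‖ ≤ (phiDeriv2 φ 1)⁻¹ * G x := by
    filter_upwards [hb, hd, ae_fderiv_p_eq_zero hint hN hθN hNΘ] with x h1 h2 h3 θ hθ
    have h4 := (h1 (θ, θ) ⟨hθ, hθ⟩).1
    have hG0 : 0 ≤ G x := (norm_nonneg _).trans h4
    rcases (M.p_nonneg θ (hNΘ hθ) x).eq_or_lt' with h5 | h5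
    · rw [h3 θ hθ h5, norm_zero]
      positivity
    · refine ContinuousLinearMap.opNorm_le_bound _ (by positivity) fun v => ?_
      have h6 := (hasFDerivAt_fp_diag hφ hφ4 (h2 θ hθ).hasFDerivAt h5).fderiv
      have h7 := ((fderiv ℝ (fun z => M.fp φ z x) (θ, θ)).le_opNorm (v, 0)).trans
        (mul_le_mul_of_nonneg_right h4 (norm_nonneg _))
      change ‖fderiv ℝ (fun z : EuclideanSpace ℝ (Fin d) × EuclideanSpace ℝ (Fin d) =>
        phiDeriv φ (M.p z.1 x / M.p z.2 x) * M.p z.1 x) (θ, θ) (v, 0)‖ ≤ _ at h7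
      rw [h6] at h7
      simp only [smul_apply, sub_apply, ContinuousLinearMap.comp_apply,
        ContinuousLinearMap.coe_fst', ContinuousLinearMap.coe_snd', map_zero, sub_zero,
        smul_eq_mul, norm_mul, Real.norm_of_nonneg hφ2.le, Prod.norm_mk, norm_zero] at h7
      rw [max_eq_left (norm_nonneg _)] at h7
      rw [mul_assoc, ← div_eq_inv_mul, le_div_iff₀' hφ2]
      exact h7
  have hm := aestronglyMeasurable_fderiv_p hN hθN hNΘ hp
  refine ⟨(hG.const_mul _).mono' hm (hbound.mono fun x hx => hx θT hθN), ?_⟩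
  have h1 := hasFDerivAt_integral_of_dominated_of_fderiv_le (F := M.p) (μ := M.ref)
    (hN.mem_nhds hθN) (by
      filter_upwards [hN.mem_nhds hθN] with θ hθ
      exact (M.measurable_p θ (hNΘ hθ)).aestronglyMeasurable) (integrable_p (hNΘ hθN)) hm hbound
    (hG.const_mul _) (hd.mono fun x hx θ hθ => (hx θ hθ).hasFDerivAt)
  refine h1.unique ((hasFDerivAt_const (1 : ℝ) θT).congr_of_eventuallyEq ?_)
  filter_upwards [hN.mem_nhds hθN] with θ hθ using integral_p (hNΘ hθ)

set_option maxSynthPendingDepth 5 in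
/-- The derivatives of `h` are those of `P_θ f(θ, α)` minus those of `g`. -/
theorem ae_fderiv_h_eq (hφ4 : ContDiffOn ℝ 4 (phiReal φ) (interior (phiDom φ)))
    (hint : M.IntegrabilityCondition φ) (hN : IsOpen N) (hθN : θT ∈ N) (hNΘ : N ⊆ M.Θ)
    (hp : ∀ᵐ x ∂M.ref, ContDiffOn ℝ 3 (fun θ => M.p θ x) N)
    (hdom : M.DominationCondition φ θT N) :
    ∀ᵐ x ∂M.P θT,
      fderiv ℝ (fun z : EuclideanSpace ℝ (Fin d) × EuclideanSpace ℝ (Fin d) =>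
        M.h φ z.1 z.2 x) (θT, θT) = (∫ y, fderiv ℝ (fun z => M.fp φ z y) (θT, θT) ∂M.ref) -
        fderiv ℝ (fun z : EuclideanSpace ℝ (Fin d) × EuclideanSpace ℝ (Fin d) =>
          M.g φ z.1 z.2 x) (θT, θT) ∧
      fderiv ℝ (fderiv ℝ fun z : EuclideanSpace ℝ (Fin d) × EuclideanSpace ℝ (Fin d) =>
        M.h φ z.1 z.2 x) (θT, θT) =
        (∫ y, fderiv ℝ (fderiv ℝ fun z => M.fp φ z y) (θT, θT) ∂M.ref) -
        fderiv ℝ (fderiv ℝ fun z : EuclideanSpace ℝ (Fin d) × EuclideanSpace ℝ (Fin d) =>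
          M.g φ z.1 z.2 x) (θT, θT) := by
  have hNN : IsOpen (N ×ˢ N) := hN.prod hN
  have hz : ((θT, θT) : EuclideanSpace ℝ (Fin d) × EuclideanSpace ℝ (Fin d)) ∈ N ×ˢ N :=
    ⟨hθN, hθN⟩
  filter_upwards [ae_contDiffOn_g hφ4 hint hθN hNΘ hp] with x hx
  have h1 : ∀ y ∈ N ×ˢ N,
      fderiv ℝ (fun z : EuclideanSpace ℝ (Fin d) × EuclideanSpace ℝ (Fin d) =>
        M.h φ z.1 z.2 x) y = fderiv ℝ (fun z => ∫ x, M.fp φ z x ∂M.ref) y -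
        fderiv ℝ (fun z : EuclideanSpace ℝ (Fin d) × EuclideanSpace ℝ (Fin d) =>
          M.g φ z.1 z.2 x) y := fun y hy => by
    have e1 := (hasFDerivAt_integral_fp hφ4 hint hN hθN hNΘ hp hdom hy).2.2
    have e2 := ((hx.contDiffAt (hNN.mem_nhds hy)).differentiableAt (by norm_num)).hasFDerivAt
    rw [e1.fderiv]
    refine ((e1.sub e2).congr_of_eventuallyEq ?_).fderiv
    filter_upwards [hNN.mem_nhds hy] with z hz
    rw [h, integral_f_eq (hNΘ hz.1)]
    rfl
  refine ⟨?_, ?_⟩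
  · rw [h1 _ hz, (hasFDerivAt_integral_fp hφ4 hint hN hθN hNΘ hp hdom hz).2.2.fderiv]
  · have e1 := (hasFDerivAt_fderiv_integral_fp hφ4 hint hN hθN hNΘ hp hdom hz).2
    have e2 := (((hx.fderiv_of_isOpen (m := 2) hNN (by norm_num)).contDiffAt
      (hNN.mem_nhds hz)).differentiableAt (by norm_num)).hasFDerivAt
    refine ((e1.sub e2).congr_of_eventuallyEq ?_).fderiv
    filter_upwards [hNN.mem_nhds hz] with z hz using h1 z hz

/-- On the diagonal, the term P_θ f contributes φ''(1) times the integral of p'(w.1 - w.2), which is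
zero, so that only -g survives. -/
theorem ae_fderiv_h_apply (hφ : IsDivergenceFunction φ)
    (hφ4 : ContDiffOn ℝ 4 (phiReal φ) (interior (phiDom φ))) (hφ2 : 0 < phiDeriv2 φ 1)
    (hint : M.IntegrabilityCondition φ) (hN : IsOpen N) (hθN : θT ∈ N) (hNΘ : N ⊆ M.Θ)
    (hp : ∀ᵐ x ∂M.ref, ContDiffOn ℝ 3 (fun θ => M.p θ x) N)
    (hdom : M.DominationCondition φ θT N) :
    ∀ᵐ x ∂M.P θT, ∀ w,
      fderiv ℝ (fun z : EuclideanSpace ℝ (Fin d) × EuclideanSpace ℝ (Fin d) =>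
        M.h φ z.1 z.2 x) (θT, θT) w = phiDeriv2 φ 1 * M.score θT x (w.2 - w.1) := by
  have hz : ((θT, θT) : EuclideanSpace ℝ (Fin d) × EuclideanSpace ℝ (Fin d)) ∈ N ×ˢ N :=
    ⟨hθN, hθN⟩
  have hd : ∀ᵐ x ∂M.ref, DifferentiableAt ℝ (fun t => M.p t x) θT := by
    filter_upwards [hp] with x hx
    exact (hx.contDiffAt (hN.mem_nhds hθN)).differentiableAt (by norm_num)
  have h0 : ∀ w, (∫ y, fderiv ℝ (fun z => M.fp φ z y) (θT, θT) ∂M.ref) w = 0 := fun w => by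
    obtain ⟨hi, hi0⟩ := integral_fderiv_p hφ hφ4 hφ2 hint hN hθN hNΘ hp hdom
    rw [ContinuousLinearMap.integral_apply
      (hasFDerivAt_integral_fp hφ4 hint hN hθN hNΘ hp hdom hz).2.1]
    have e : ∀ᵐ y ∂M.ref, fderiv ℝ (fun z => M.fp φ z y) (θT, θT) w =
        phiDeriv2 φ 1 * fderiv ℝ (fun t => M.p t y) θT (w.1 - w.2) := by
      filter_upwards [ae_support hint (hNΘ hθN), hd,
        ae_fderiv_p_eq_zero hint hN hθN hNΘ] with y hy hdy h0y
      rcases hy with hy | ⟨hy, -⟩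
      · have : (fun z => M.fp φ z y) =ᶠ[𝓝 (θT, θT)] fun _ => 0 := by
          filter_upwards [(hN.prod hN).mem_nhds hz] with z hz
          simp [fp, hy z.1 (hNΘ hz.1)]
        rw [this.fderiv_eq, h0y θT hθN (hy θT (hNΘ hθN))]
        simp
      · have := (hasFDerivAt_fp_diag hφ hφ4 hdy.hasFDerivAt (hy θT (hNΘ hθN))).fderiv
        change fderiv ℝ (fun z : EuclideanSpace ℝ (Fin d) × EuclideanSpace ℝ (Fin d) =>
          phiDeriv φ (M.p z.1 y / M.p z.2 y) * M.p z.1 y) (θT, θT) w = _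
        rw [this]
        simp
    rw [integral_congr_ae e, integral_const_mul, ← ContinuousLinearMap.integral_apply hi, hi0]
    simp
  filter_upwards [ae_fderiv_h_eq hφ4 hint hN hθN hNΘ hp hdom, (ae_P_iff (hNΘ hθN)).2
    (ae_of_all _ fun _ h => h), P_absolutelyContinuous θT hd] with x hx hpos hdx w
  rw [hx.1, sub_apply, h0 w]
  change 0 - fderiv ℝ (fun z : EuclideanSpace ℝ (Fin d) × EuclideanSpace ℝ (Fin d) =>
    M.p z.1 x / M.p z.2 x * phiDeriv φ (M.p z.1 x / M.p z.2 x) -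
      phiReal φ (M.p z.1 x / M.p z.2 x)) (θT, θT) w = _
  rw [(hasFDerivAt_g_diag hφ hφ4 hdx.hasFDerivAt hpos).fderiv]
  simp only [score, smul_apply, sub_apply, ContinuousLinearMap.comp_apply,
    ContinuousLinearMap.coe_fst', ContinuousLinearMap.coe_snd', map_sub, smul_eq_mul]
  ring

/-- The derivative of h in the direction (0, v) is φ''(1) times the score at v, so the second moment
assumed for h' passes to the score. -/
theorem memLp_score (hφ : IsDivergenceFunction φ)
    (hφ4 : ContDiffOn ℝ 4 (phiReal φ) (interior (phiDom φ))) (hφ2 : 0 < phiDeriv2 φ 1)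
    (hint : M.IntegrabilityCondition φ) (hN : IsOpen N) (hθN : θT ∈ N) (hNΘ : N ⊆ M.Θ)
    (hp : ∀ᵐ x ∂M.ref, ContDiffOn ℝ 3 (fun θ => M.p θ x) N)
    (hdom : M.DominationCondition φ θT N) (hmom : M.MomentCondition φ θT)
    (v : EuclideanSpace ℝ (Fin d)) : MemLp (fun x => M.score θT x v) 2 (M.P θT) := by
  have hm : AEStronglyMeasurable (fun x => M.score θT x v) (M.P θT) :=
    (aestronglyMeasurable_score hN hθN hNΘ hp).apply_continuousLinearMap v
  rw [memLp_two_iff_integrable_sq hm]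
  refine (hmom.first.const_mul ((phiDeriv2 φ 1)⁻¹ ^ 2 * ‖v‖ ^ 2)).mono' (hm.pow 2) ?_
  filter_upwards [ae_fderiv_h_apply hφ hφ4 hφ2 hint hN hθN hNΘ hp hdom] with x hx
  have h1 := hx (0, v)
  simp only [sub_zero] at h1
  have h2 := (fderiv ℝ (fun z : EuclideanSpace ℝ (Fin d) × EuclideanSpace ℝ (Fin d) =>
        M.h φ z.1 z.2 x) (θT, θT)).le_opNorm (0, v)
  rw [← norm_iteratedFDeriv_fderiv, norm_iteratedFDeriv_zero]
  rw [h1, norm_mul, Real.norm_of_nonneg hφ2.le, Prod.norm_mk, norm_zero,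
    max_eq_right (norm_nonneg v), ← le_div_iff₀' hφ2, div_eq_inv_mul] at h2
  rw [norm_pow]
  refine (pow_le_pow_left₀ (norm_nonneg _) h2 2).trans (le_of_eq ?_)
  ring

theorem integral_score (hφ : IsDivergenceFunction φ)
    (hφ4 : ContDiffOn ℝ 4 (phiReal φ) (interior (phiDom φ))) (hφ2 : 0 < phiDeriv2 φ 1)
    (hint : M.IntegrabilityCondition φ) (hN : IsOpen N) (hθN : θT ∈ N) (hNΘ : N ⊆ M.Θ)
    (hp : ∀ᵐ x ∂M.ref, ContDiffOn ℝ 3 (fun θ => M.p θ x) N)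
    (hdom : M.DominationCondition φ θT N) (v : EuclideanSpace ℝ (Fin d)) :
    ∫ x, M.score θT x v ∂M.P θT = 0 := by
  obtain ⟨hi, hi0⟩ := integral_fderiv_p hφ hφ4 hφ2 hint hN hθN hNΘ hp hdom
  rw [integral_P (hNΘ hθN)]
  have : ∀ᵐ x ∂M.ref, M.p θT x • M.score θT x v = fderiv ℝ (fun t => M.p t x) θT v := by
    filter_upwards [ae_fderiv_p_eq_zero hint hN hθN hNΘ] with x hx
    rcases eq_or_ne (M.p θT x) 0 with h0 | h0
    · rw [hx θT hθN h0, h0]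
      simp
    · simp [score, h0]
  rw [integral_congr_ae this, ← ContinuousLinearMap.integral_apply hi, hi0]
  simp

theorem fisherInfo_apply (hθ : θT ∈ M.Θ) (i j : Fin d) :
    M.fisherInfo θT i j = ∫ x, M.score θT x (EuclideanSpace.single i 1) *
      M.score θT x (EuclideanSpace.single j 1) ∂M.P θT := by
  rw [integral_P hθ, fisherInfo, Matrix.of_apply]
  refine integral_congr_ae (ae_of_all _ fun x => ?_)
  rcases eq_or_ne (M.p θT x) 0 with h0 | h0
  · simp [h0]
  · simp only [score, smul_apply, smul_eq_mul]
    field_simp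

end ParametricModel

/-! ### Square roots of positive definite quadratic forms -/

section SquareRoot

open scoped MatrixOrder Matrix

/-- A positive definite matrix is the Gram matrix of a linear change of variables. -/
theorem Matrix.PosSemidef.exists_continuousLinearEquiv {d : ℕ} {S : Matrix (Fin d) (Fin d) ℝ}
    (hS : S.PosSemidef) (hdet : S.det ≠ 0) :
    ∃ A : EuclideanSpace ℝ (Fin d) ≃L[ℝ] EuclideanSpace ℝ (Fin d),
      ∀ v, ‖A v‖ ^ 2 = v.ofLp ⬝ᵥ (S *ᵥ v.ofLp) := by
  set B := CFC.sqrt S with hB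
  have hBB : B * B = S := CFC.sqrt_mul_sqrt_self S hS.nonneg
  have hBs : Bᵀ = B := by
    have := (CFC.sqrt_nonneg S).isSelfAdjoint.star_eq
    rwa [Matrix.star_eq_conjTranspose, Matrix.conjTranspose_eq_transpose_of_trivial] at this
  have key : ∀ v : EuclideanSpace ℝ (Fin d),
      ‖Matrix.toEuclideanLin B v‖ ^ 2 = v.ofLp ⬝ᵥ (S *ᵥ v.ofLp) := fun v => by
    rw [EuclideanSpace.real_norm_sq_eq, ← hBB, ← Matrix.mulVec_mulVec, Matrix.dotProduct_mulVec,
      ← Matrix.mulVec_transpose, hBs]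
    simp [dotProduct, pow_two, Matrix.toLpLin_apply]
  have hinj : Function.Injective (Matrix.toEuclideanLin B) := by
    rw [injective_iff_map_eq_zero]
    intro v hv
    have h1 := key v
    rw [hv, norm_zero, zero_pow two_ne_zero] at h1
    have h2 : S *ᵥ v.ofLp = 0 := by
      refine (hS.dotProduct_mulVec_zero_iff v.ofLp).1 ?_
      simpa using h1.symm
    have := Matrix.eq_zero_of_mulVec_eq_zero hdet h2
    ext i
    exact congrFun this i
  refine ⟨(LinearEquiv.ofInjectiveEndo _ hinj).toContinuousLinearEquiv, fun v => key v⟩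

end SquareRoot

/-! ### Fisher information and the second order expansion of `h` -/

namespace ParametricModel

variable {d : ℕ} {𝒳 : Type*} [MeasurableSpace 𝒳] {M : ParametricModel d 𝒳} {φ : ℝ → ℝ≥0∞}
  {θT : EuclideanSpace ℝ (Fin d)} {N : Set (EuclideanSpace ℝ (Fin d))}

open scoped Matrix in
theorem integral_score_sq (hθ : θT ∈ M.Θ)
    (hL : ∀ v, MemLp (fun x => M.score θT x v) 2 (M.P θT)) (v : EuclideanSpace ℝ (Fin d)) :
    ∫ x, M.score θT x v ^ 2 ∂M.P θT = v.ofLp ⬝ᵥ (M.fisherInfo θT *ᵥ v.ofLp) := by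
  set e : Fin d → EuclideanSpace ℝ (Fin d) := fun i => EuclideanSpace.single i 1
  have h1 : ∀ x, M.score θT x v ^ 2 =
      ∑ i, ∑ j, v.ofLp i * v.ofLp j * (M.score θT x (e i) * M.score θT x (e j)) := fun x => by
    have : v = ∑ i, v.ofLp i • e i := by
      have := (EuclideanSpace.basisFun (Fin d) ℝ).sum_repr v
      simpa [e] using this.symm
    conv_lhs => rw [this]
    rw [map_sum, pow_two, Finset.sum_mul_sum]
    refine Finset.sum_congr rfl fun i _ => Finset.sum_congr rfl fun j _ => ?_
    simp only [map_smul, smul_eq_mul]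
    ring
  have hi : ∀ i j, Integrable (fun x => M.score θT x (e i) * M.score θT x (e j)) (M.P θT) :=
    fun i j => (hL (e i)).integrable_mul (hL (e j))
  simp_rw [h1]
  rw [integral_finsetSum _ fun i _ => integrable_finsetSum _ fun j _ => (hi i j).const_mul _]
  simp only [dotProduct, Matrix.mulVec, Finset.mul_sum]
  refine Finset.sum_congr rfl fun i _ => ?_
  rw [integral_finsetSum _ fun j _ => (hi i j).const_mul _]
  refine Finset.sum_congr rfl fun j _ => ?_
  rw [integral_const_mul, fisherInfo_apply hθ]
  ring

open scoped Matrix in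
theorem posSemidef_fisherInfo (hθ : θT ∈ M.Θ)
    (hL : ∀ v, MemLp (fun x => M.score θT x v) 2 (M.P θT)) : (M.fisherInfo θT).PosSemidef := by
  refine Matrix.PosSemidef.of_dotProduct_mulVec_nonneg ?_ fun v => ?_
  · ext i j
    rw [Matrix.conjTranspose_apply, fisherInfo_apply hθ, fisherInfo_apply hθ]
    simp [mul_comm]
  · have := integral_score_sq hθ hL (WithLp.toLp 2 v)
    rw [star_trivial, ← this]
    exact integral_nonneg fun x => sq_nonneg _

theorem aestronglyMeasurable_fderiv_h (hφ : IsDivergenceFunction φ) (hN : IsOpen N)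
    (hNΘ : N ⊆ M.Θ) (hdom : M.DominationCondition φ θT N)
    {y : EuclideanSpace ℝ (Fin d) × EuclideanSpace ℝ (Fin d)} (hy : y ∈ N ×ˢ N) :
    AEStronglyMeasurable (fun x => fderiv ℝ
      (fun z : EuclideanSpace ℝ (Fin d) × EuclideanSpace ℝ (Fin d) => M.h φ z.1 z.2 x) y)
      (M.P θT) := by
  have hNN : IsOpen (N ×ˢ N) := hN.prod hN
  obtain ⟨H, -, hH⟩ := hdom.dom_h
  have h1 : ∀ᶠ z : EuclideanSpace ℝ (Fin d) × EuclideanSpace ℝ (Fin d) in 𝓝 y,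
      AEStronglyMeasurable (M.h φ z.1 z.2) (M.P θT) := by
    filter_upwards [hNN.mem_nhds hy] with z hz
    exact (measurable_h hφ (hNΘ hz.1) (hNΘ hz.2)).aestronglyMeasurable
  exact aestronglyMeasurable_fderiv h1 (hH.mono fun x hx =>
    (hx.1.contDiffAt (hNN.mem_nhds hy)).differentiableAt (by norm_num))

set_option maxSynthPendingDepth 5 in
theorem integrable_fderiv_fderiv_h (hφ : IsDivergenceFunction φ) (hN : IsOpen N) (hθN : θT ∈ N)
    (hNΘ : N ⊆ M.Θ) (hdom : M.DominationCondition φ θT N) (hmom : M.MomentCondition φ θT) :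
    Integrable (fun x => fderiv ℝ (fderiv ℝ
      fun z : EuclideanSpace ℝ (Fin d) × EuclideanSpace ℝ (Fin d) => M.h φ z.1 z.2 x) (θT, θT))
      (M.P θT) := by
  have hNN : IsOpen (N ×ˢ N) := hN.prod hN
  have hz : ((θT, θT) : EuclideanSpace ℝ (Fin d) × EuclideanSpace ℝ (Fin d)) ∈ N ×ˢ N :=
    ⟨hθN, hθN⟩
  obtain ⟨H, -, hH⟩ := hdom.dom_h
  have hm : AEStronglyMeasurable (fun x => fderiv ℝ (fderiv ℝ
      fun z : EuclideanSpace ℝ (Fin d) × EuclideanSpace ℝ (Fin d) => M.h φ z.1 z.2 x) (θT, θT))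
      (M.P θT) := by
    have h1 : ∀ᶠ y : EuclideanSpace ℝ (Fin d) × EuclideanSpace ℝ (Fin d) in 𝓝 (θT, θT),
        AEStronglyMeasurable (fun x => fderiv ℝ
          (fun z : EuclideanSpace ℝ (Fin d) × EuclideanSpace ℝ (Fin d) => M.h φ z.1 z.2 x) y)
          (M.P θT) := by
      filter_upwards [hNN.mem_nhds hz] with y hy using
        aestronglyMeasurable_fderiv_h hφ hN hNΘ hdom hy
    exact aestronglyMeasurable_fderiv h1 (hH.mono fun x hx =>
      ((hx.1.fderiv_of_isOpen (m := 2) hNN (by norm_num)).contDiffAt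
        (hNN.mem_nhds hz)).differentiableAt (by norm_num))
  refine (integrable_norm_iff hm).1 (hmom.second.congr (ae_of_all _ fun x => ?_))
  simp only
  rw [← norm_iteratedFDeriv_fderiv, ← norm_iteratedFDeriv_fderiv, norm_iteratedFDeriv_zero]

set_option maxSynthPendingDepth 5 in
-- The Hessians of P_θ f and of g are not computed separately. Written as one integral for the
-- dominating measure, they form the Hessian of f p_θ - p_θT g with the last density frozen at θT.
-- There the second derivatives of the density cancel pointwise, leaving φ''(1)(p'(w.1)² -
-- p'(w.2)²)/p_θT.
theorem integral_fderiv_fderiv_h (hφ : IsDivergenceFunction φ)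
    (hφ4 : ContDiffOn ℝ 4 (phiReal φ) (interior (phiDom φ)))
    (hint : M.IntegrabilityCondition φ) (hN : IsOpen N) (hθN : θT ∈ N) (hNΘ : N ⊆ M.Θ)
    (hp : ∀ᵐ x ∂M.ref, ContDiffOn ℝ 3 (fun θ => M.p θ x) N)
    (hdom : M.DominationCondition φ θT N) (hmom : M.MomentCondition φ θT)
    (hL : ∀ v, MemLp (fun x => M.score θT x v) 2 (M.P θT))
    (w : EuclideanSpace ℝ (Fin d) × EuclideanSpace ℝ (Fin d)) :
    (∫ x, fderiv ℝ (fderiv ℝ fun z : EuclideanSpace ℝ (Fin d) × EuclideanSpace ℝ (Fin d) =>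
      M.h φ z.1 z.2 x) (θT, θT) ∂M.P θT) w w =
      phiDeriv2 φ 1 * (∫ x, M.score θT x w.1 ^ 2 ∂M.P θT - ∫ x, M.score θT x w.2 ^ 2 ∂M.P θT) := by
  have := isProbabilityMeasure_P (hNΘ hθN)
  have hz : ((θT, θT) : EuclideanSpace ℝ (Fin d) × EuclideanSpace ℝ (Fin d)) ∈ N ×ˢ N :=
    ⟨hθN, hθN⟩
  have hi := integrable_fderiv_fderiv_h hφ hN hθN hNΘ hdom hmom
  have hF := (hasFDerivAt_fderiv_integral_fp hφ4 hint hN hθN hNΘ hp hdom hz).1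
  have happ : ∀ {ν : Measure 𝒳}
      {L : 𝒳 → (EuclideanSpace ℝ (Fin d) × EuclideanSpace ℝ (Fin d)) →L[ℝ]
      (EuclideanSpace ℝ (Fin d) × EuclideanSpace ℝ (Fin d)) →L[ℝ] ℝ}, Integrable L ν →
      Integrable (fun x => L x w w) ν ∧ (∫ x, L x ∂ν) w w = ∫ x, L x w w ∂ν := fun {ν L} hL => by
    have h1 : Integrable (fun x => L x w) ν := hL.apply_continuousLinearMap w
    refine ⟨h1.apply_continuousLinearMap w, ?_⟩
    rw [ContinuousLinearMap.integral_apply hL, ContinuousLinearMap.integral_apply h1]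
  rw [(happ hi).2]
  set q : 𝒳 → ℝ := fun x => fderiv ℝ (fderiv ℝ
    fun z : EuclideanSpace ℝ (Fin d) × EuclideanSpace ℝ (Fin d) => M.g φ z.1 z.2 x) (θT, θT) w w
  set k : ℝ := ∫ x, fderiv ℝ (fderiv ℝ fun z => M.fp φ z x) (θT, θT) w w ∂M.ref with hk
  have he : ∀ᵐ x ∂M.P θT, fderiv ℝ (fderiv ℝ
      fun z : EuclideanSpace ℝ (Fin d) × EuclideanSpace ℝ (Fin d) => M.h φ z.1 z.2 x) (θT, θT) w w =
      k - q x := by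
    filter_upwards [ae_fderiv_h_eq hφ4 hint hN hθN hNΘ hp hdom] with x hx
    rw [hx.2, sub_apply, sub_apply, (happ hF).2]
  -- The second derivative of g inherits integrability from that of h, since q and the latter add up
  -- a.e. to the constant k.
  have hqi : Integrable q (M.P θT) := by
    have h1 : Integrable (fun x => k - q x) (M.P θT) := (happ hi).1.congr he
    refine ((integrable_const k).sub h1).congr (ae_of_all _ fun x => ?_)
    simp
  rw [integral_congr_ae he, integral_sub (integrable_const k) hqi, integral_const, probReal_univ,
    one_smul, integral_P (hNΘ hθN), hk,
    ← integral_sub (happ hF).1 ((integrable_P_iff (hNΘ hθN)).1 hqi),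
    ← integral_sub (hL _).integrable_sq (hL _).integrable_sq, ← integral_const_mul,
    integral_P (hNΘ hθN)]
  refine integral_congr_ae ?_
  filter_upwards [ae_support hint (hNΘ hθN), hp] with x hx hpx
  rcases hx with hx | ⟨hx, hr⟩
  · have h1 : ∀ y ∈ N ×ˢ N, fderiv ℝ (fun z => M.fp φ z x) y = 0 := fun y hy => by
      have : (fun z => M.fp φ z x) =ᶠ[𝓝 y] fun _ => 0 := by
        filter_upwards [(hN.prod hN).mem_nhds hy] with z hz
        simp [fp, hx z.1 (hNΘ hz.1)]
      rw [this.fderiv_eq]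
      simp
    have h2 : (fderiv ℝ fun z => M.fp φ z x) =ᶠ[𝓝 (θT, θT)] fun _ => 0 := by
      filter_upwards [(hN.prod hN).mem_nhds hz] with y hy using h1 y hy
    rw [h2.fderiv_eq, hx θT (hNΘ hθN)]
    simp
  · have h1 := second_fderiv_fp_sub_g hφ hφ4 hN hpx (fun θ hθ => hx θ (hNΘ hθ))
      (fun θ hθ α hα => hr θ (hNΘ hθ) α (hNΘ hα)) hθN w
    refine h1.trans ?_
    have := (hx θT (hNΘ hθN)).ne'
    simp only [score, smul_apply, smul_eq_mul]
    field_simp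

set_option maxSynthPendingDepth 5 in
/-- The local quadratic expansion of `h` at the true parameter, in coordinates that turn the Fisher
information into the identity. -/
theorem exists_local_expansion (hφ : IsDivergenceFunction φ)
    (hφ4 : ContDiffOn ℝ 4 (phiReal φ) (interior (phiDom φ))) (hφ2 : 0 < phiDeriv2 φ 1)
    (hint : M.IntegrabilityCondition φ) (hN : IsOpen N) (hθN : θT ∈ N) (hNΘ : N ⊆ M.Θ)
    (hp : ∀ᵐ x ∂M.ref, ContDiffOn ℝ 3 (fun θ => M.p θ x) N)
    (hdom : M.DominationCondition φ θT N) (hmom : M.MomentCondition φ θT) :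
    ∃ (A : EuclideanSpace ℝ (Fin d) ≃L[ℝ] EuclideanSpace ℝ (Fin d))
      (ζ : 𝒳 → EuclideanSpace ℝ (Fin d))
      (Λ : 𝒳 → (EuclideanSpace ℝ (Fin d) × EuclideanSpace ℝ (Fin d)) →L[ℝ]
        (EuclideanSpace ℝ (Fin d) × EuclideanSpace ℝ (Fin d)) →L[ℝ] ℝ) (H : 𝒳 → ℝ) (ρ : ℝ),
      0 < ρ ∧ Metric.ball θT ρ ⊆ N ∧ Measurable ζ ∧
      (∀ w, ∫ x, inner ℝ (ζ x) w ∂M.P θT = 0) ∧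
      (∀ w, ∫ x, inner ℝ (ζ x) w ^ 2 ∂M.P θT = ‖w‖ ^ 2) ∧
      StronglyMeasurable Λ ∧ Integrable Λ (M.P θT) ∧
      (∀ w, (∫ x, Λ x ∂M.P θT) w w = phiDeriv2 φ 1 * (‖A w.1‖ ^ 2 - ‖A w.2‖ ^ 2)) ∧
      StronglyMeasurable H ∧ Integrable H (M.P θT) ∧
      ∀ᵐ x ∂M.P θT, ∀ w : EuclideanSpace ℝ (Fin d) × EuclideanSpace ℝ (Fin d), ‖w‖ < ρ →
        |M.h φ (θT + w.1) (θT + w.2) x - phiDeriv2 φ 1 * inner ℝ (ζ x) (A w.2 - A w.1) -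
          1 / 2 * Λ x w w| ≤ H x * ‖w‖ ^ 3 := by
  have hθΘ := hNΘ hθN
  have hL := memLp_score hφ hφ4 hφ2 hint hN hθN hNΘ hp hdom hmom
  obtain ⟨A, hA⟩ := (posSemidef_fisherInfo hθΘ hL).exists_continuousLinearEquiv
    hmom.fisher_nonsingular
  have hA' : ∀ v, ∫ x, M.score θT x v ^ 2 ∂M.P θT = ‖A v‖ ^ 2 := fun v => by
    rw [integral_score_sq hθΘ hL, hA]
  obtain ⟨ρ, hρ, hρN⟩ := Metric.isOpen_iff.1 hN θT hθN
  obtain ⟨H, hHi, hH⟩ := hdom.dom_h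
  -- The whitened score: the Riesz representative of the score composed with A⁻¹, so that ⟨ζ₀, A v⟩
  -- is the score at v and the covariance is the identity.
  set ζ₀ : 𝒳 → EuclideanSpace ℝ (Fin d) := fun x =>
    (InnerProductSpace.toDual ℝ _).symm ((M.score θT x).comp
      (A.symm : EuclideanSpace ℝ (Fin d) →L[ℝ] EuclideanSpace ℝ (Fin d))) with hζ₀
  have hζ₀i : ∀ x w, inner ℝ (ζ₀ x) w = M.score θT x (A.symm w) := fun x w => by
    rw [hζ₀, InnerProductSpace.toDual_symm_apply]
    rfl
  have hζ₀m : AEMeasurable ζ₀ (M.P θT) := by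
    refine AEStronglyMeasurable.aemeasurable ?_
    refine (LinearIsometryEquiv.continuous _).comp_aestronglyMeasurable ?_
    exact ContinuousLinearMap.aestronglyMeasurable_of_apply fun v =>
      (aestronglyMeasurable_score hN hθN hNΘ hp).apply_continuousLinearMap (A.symm v)
  have hΛi := integrable_fderiv_fderiv_h hφ hN hθN hNΘ hdom hmom
  have hζe := hζ₀m.ae_eq_mk
  have hΛe := hΛi.aestronglyMeasurable.ae_eq_mk
  have hHe := hHi.aestronglyMeasurable.ae_eq_mk
  refine ⟨A, hζ₀m.mk _, hΛi.aestronglyMeasurable.mk _, hHi.aestronglyMeasurable.mk _, ρ, hρ, hρN,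
    hζ₀m.measurable_mk, fun w => ?_, fun w => ?_, hΛi.aestronglyMeasurable.stronglyMeasurable_mk,
    hΛi.congr hΛe, fun w => ?_, hHi.aestronglyMeasurable.stronglyMeasurable_mk, hHi.congr hHe, ?_⟩
  · rw [← integral_score hφ hφ4 hφ2 hint hN hθN hNΘ hp hdom (A.symm w)]
    refine integral_congr_ae ?_
    filter_upwards [hζe] with x hx
    rw [← hx, hζ₀i]
  · have := hA' (A.symm w)
    rw [A.apply_symm_apply] at this
    rw [← this]
    refine integral_congr_ae ?_
    filter_upwards [hζe] with x hx
    rw [← hx, hζ₀i]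
  · rw [← integral_congr_ae hΛe,
      integral_fderiv_fderiv_h hφ hφ4 hint hN hθN hNΘ hp hdom hmom hL, hA', hA']
  · filter_upwards [hζe, hΛe, hHe, hH, h_self hφ hθΘ,
      ae_fderiv_h_apply hφ hφ4 hφ2 hint hN hθN hNΘ hp hdom] with x h1 h2 h3 h4 h5 h6 w hw
    rw [← h1, ← h2, ← h3, hζ₀i, map_sub, A.symm_apply_apply, A.symm_apply_apply]
    have hsub : Metric.ball ((θT, θT) : EuclideanSpace ℝ (Fin d) × EuclideanSpace ℝ (Fin d)) ρ ⊆
        N ×ˢ N := by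
      rw [← ball_prod_same]
      exact Set.prod_mono hρN hρN
    have := norm_sub_taylor_two_le (z := (θT + w.1, θT + w.2)) (h4.1.mono hsub)
      (fun y hy => h4.2 y (hsub hy)) (by
        have : (θT + w.1, θT + w.2) = (θT, θT) + w := rfl
        rw [this]
        simpa using hw)
    have e : (θT + w.1, θT + w.2) - (θT, θT) = w := by ext <;> simp
    rw [e, h6 w] at this
    simp only [h5, sub_zero, smul_eq_mul, Real.norm_eq_abs] at this
    exact this

end ParametricModel

/-! ### Events of probability tending to one -/

section HighProbability

variable {Ω : Type*} [MeasurableSpace Ω] {μ : Measure Ω} {q q' : ℕ → Ω → Prop}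

/-- The property `q n` holds with probability tending to one (for the outer measure). -/
def HoldsWithHighProb (μ : Measure Ω) (q : ℕ → Ω → Prop) : Prop :=
  Tendsto (fun n => μ {ω | ¬ q n ω}) atTop (𝓝 0)

theorem HoldsWithHighProb.mono (h : HoldsWithHighProb μ q) (hq : ∀ n ω, q n ω → q' n ω) :
    HoldsWithHighProb μ q' :=
  tendsto_of_tendsto_of_tendsto_of_le_of_le tendsto_const_nhds h (fun _ => zero_le)
    fun n => measure_mono fun ω hω hω' => hω (hq n ω hω')

theorem HoldsWithHighProb.and (h : HoldsWithHighProb μ q) (h' : HoldsWithHighProb μ q') :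
    HoldsWithHighProb μ fun n ω => q n ω ∧ q' n ω := by
  have := Tendsto.add h h'
  rw [add_zero] at this
  refine tendsto_of_tendsto_of_tendsto_of_le_of_le tendsto_const_nhds this (fun _ => zero_le)
    fun n => (measure_mono fun ω hω => ?_).trans (measure_union_le _ _)
  by_cases h1 : q n ω
  · exact Or.inr fun h2 => hω ⟨h1, h2⟩
  · exact Or.inl h1

theorem holdsWithHighProb_of_ae {r : Ω → Prop} (h : ∀ᵐ ω ∂μ, r ω) :
    HoldsWithHighProb μ fun _ ω => r ω := by
  have : μ {ω | ¬ r ω} = 0 := ae_iff.1 h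
  simp only [HoldsWithHighProb, this]
  exact tendsto_const_nhds

theorem holdsWithHighProb_of_eventually (h : ∀ᶠ n in atTop, ∀ ω, q n ω) :
    HoldsWithHighProb μ q := by
  refine tendsto_nhds_of_eventually_eq ?_
  filter_upwards [h] with n hn
  simp [hn]

/-- Serves to work on a tightness event of probability at least 1 - δ only; the main event q' may
depend on δ, as the radii and tolerances chosen from the tightness bound do. -/
theorem holdsWithHighProb_of_forall_le
    (h : ∀ δ : ℝ≥0∞, 0 < δ → ∃ q' : ℕ → Ω → Prop, HoldsWithHighProb μ q' ∧
      ∃ r : ℕ → Ω → Prop, (∀ᶠ n in atTop, μ {ω | ¬ r n ω} ≤ δ) ∧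
        ∀ n ω, q' n ω → r n ω → q n ω) : HoldsWithHighProb μ q := by
  refine ENNReal.tendsto_nhds_zero.2 fun δ hδ => ?_
  obtain ⟨q', hq', r, hr, hqr⟩ := h (δ / 2) (ENNReal.half_pos hδ.ne')
  filter_upwards [ENNReal.tendsto_nhds_zero.1 hq' (δ / 2) (ENNReal.half_pos hδ.ne'), hr]
    with n h1 h2
  calc μ {ω | ¬ q n ω} ≤ μ ({ω | ¬ q' n ω} ∪ {ω | ¬ r n ω}) := measure_mono fun ω hω => by
        by_cases h3 : q' n ω
        · exact Or.inr fun h4 => hω (hqr n ω h3 h4)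
        · exact Or.inl h3
    _ ≤ μ {ω | ¬ q' n ω} + μ {ω | ¬ r n ω} := measure_union_le _ _
    _ ≤ δ / 2 + δ / 2 := add_le_add h1 h2
    _ = δ := ENNReal.add_halves δ

/-- A sequence that converges in distribution is bounded in probability. -/
theorem exists_measure_norm_le_of_tendstoInDistribution {E : Type*} [NormedAddCommGroup E]
    [MeasurableSpace E] [BorelSpace E] [IsProbabilityMeasure μ] {Z : ℕ → Ω → E} {ν : Measure E}
    [IsProbabilityMeasure ν] (h : TendstoInDistribution Z atTop id (fun _ => μ) ν) {δ : ℝ≥0∞}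
    (hδ : 0 < δ) : ∃ R : ℝ, 0 < R ∧ ∀ᶠ n in atTop, μ {ω | ¬ ‖Z n ω‖ < R} ≤ δ := by
  -- The limit law has small tails, and the portmanteau theorem for the closed sets {k ≤ ‖z‖}
  -- carries them over to Z n for large n.
  have hlim : Tendsto (fun k : ℕ => ν {z | (k : ℝ) ≤ ‖z‖}) atTop (𝓝 0) := by
    have hanti : Antitone fun k : ℕ => {z : E | (k : ℝ) ≤ ‖z‖} := fun k k' hk z hz =>
      le_trans (Nat.cast_le.2 hk : (k : ℝ) ≤ k') hz
    have := tendsto_measure_iInter_atTop (μ := ν) (s := fun k : ℕ => {z : E | (k : ℝ) ≤ ‖z‖})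
      (fun k => (measurableSet_le measurable_const measurable_norm).nullMeasurableSet) hanti
      ⟨0, measure_ne_top _ _⟩
    have he : ⋂ k : ℕ, {z : E | (k : ℝ) ≤ ‖z‖} = ∅ := by
      refine Set.eq_empty_of_forall_notMem fun z hz => ?_
      obtain ⟨k, hk⟩ := exists_nat_gt ‖z‖
      exact absurd (Set.mem_iInter.1 hz k) (not_le.2 hk)
    rwa [he, measure_empty] at this
  obtain ⟨k, hk, hk0⟩ := (((tendsto_order.1 hlim).2 δ hδ).and (eventually_gt_atTop 0)).exists
  have hc : IsClosed {z : E | (k : ℝ) ≤ ‖z‖} := isClosed_le continuous_const continuous_norm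
  have hls := ProbabilityMeasure.limsup_measure_closed_le_of_tendsto h.tendsto hc
  simp only [ProbabilityMeasure.coe_mk, Measure.map_id] at hls
  refine ⟨k, by exact_mod_cast hk0, ?_⟩
  filter_upwards [eventually_lt_of_limsup_lt (hls.trans_lt hk)] with n hn
  rw [Measure.map_apply_of_aemeasurable (h.forall_aemeasurable n) hc.measurableSet] at hn
  simp only [not_lt]
  exact hn.le

end HighProbability

/-! ### Uniform quadratic expansion of the empirical criterion -/

namespace ParametricModel

variable {d : ℕ} {𝒳 Ω : Type*} [MeasurableSpace 𝒳] [MeasurableSpace Ω]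
  {M : ParametricModel d 𝒳} {φ : ℝ → ℝ≥0∞} {θT : EuclideanSpace ℝ (Fin d)}
  {N : Set (EuclideanSpace ℝ (Fin d))} {μ : Measure Ω} [IsProbabilityMeasure μ] {X : ℕ → Ω → 𝒳}

set_option maxSynthPendingDepth 5 in
/-- The empirical criterion is uniformly close to a difference of squares near the origin. -/
theorem exists_empH_expansion {c : ℝ} (hc : 0 < c) (hX : ∀ i, Measurable (X i))
    (hindep : iIndepFun X μ) (hlaw : ∀ i, μ.map (X i) = M.P θT)
    {A : EuclideanSpace ℝ (Fin d) ≃L[ℝ] EuclideanSpace ℝ (Fin d)}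
    {ζ : 𝒳 → EuclideanSpace ℝ (Fin d)}
    {Λ : 𝒳 → (EuclideanSpace ℝ (Fin d) × EuclideanSpace ℝ (Fin d)) →L[ℝ]
      (EuclideanSpace ℝ (Fin d) × EuclideanSpace ℝ (Fin d)) →L[ℝ] ℝ} {H : 𝒳 → ℝ} {ρ : ℝ}
    (hρ : 0 < ρ) (hΛm : StronglyMeasurable Λ) (hΛ : Integrable Λ (M.P θT))
    (hΛA : ∀ w, (∫ x, Λ x ∂M.P θT) w w = c * (‖A w.1‖ ^ 2 - ‖A w.2‖ ^ 2))
    (hHm : StronglyMeasurable H) (hH : Integrable H (M.P θT))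
    (hexp : ∀ᵐ x ∂M.P θT, ∀ w : EuclideanSpace ℝ (Fin d) × EuclideanSpace ℝ (Fin d), ‖w‖ < ρ →
        |M.h φ (θT + w.1) (θT + w.2) x - c * inner ℝ (ζ x) (A w.2 - A w.1) -
          1 / 2 * Λ x w w| ≤ H x * ‖w‖ ^ 3) {η : ℝ} (hη : 0 < η) :
    ∃ ε > 0, HoldsWithHighProb μ fun n ω => ∀ u v, ‖u‖ ≤ ε → ‖v‖ ≤ ε →
      |M.empH φ X n ω (θT + A.symm u) (θT + A.symm v) / c -
        (‖u - (n : ℝ)⁻¹ • ∑ i ∈ Finset.range n, ζ (X i ω)‖ ^ 2 / 2 -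
          ‖v - (n : ℝ)⁻¹ • ∑ i ∈ Finset.range n, ζ (X i ω)‖ ^ 2 / 2)| ≤
        η * (‖u‖ ^ 2 + ‖v‖ ^ 2) := by
  set a := ‖(A.symm : EuclideanSpace ℝ (Fin d) →L[ℝ] EuclideanSpace ℝ (Fin d))‖ with ha
  have ha0 : 0 ≤ a := norm_nonneg _
  have hA : ∀ v, ‖A.symm v‖ ≤ a * ‖v‖ :=
    (A.symm : EuclideanSpace ℝ (Fin d) →L[ℝ] EuclideanSpace ℝ (Fin d)).le_opNorm
  set C : ℝ := |∫ x, H x ∂M.P θT| + 1 with hC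
  have hC0 : 0 < C := by positivity
  -- The error allowance cη(‖u‖² + ‖v‖²) is split in two. The choice of δ makes half the fluctuation
  -- of the second derivative use at most one half, and the second bound on ε does the same for the
  -- cubic remainder; the first keeps w inside the ball of radius ρ.
  set δ : ℝ := c * η / (a ^ 2 + 1) with hδ
  have hδ0 : 0 < δ := by positivity
  set ε : ℝ := min (ρ / (a + 1) / 2) (c * η / (C * a ^ 3 + 1) / 2) with hε
  have hε0 : 0 < ε := by positivity
  refine ⟨ε, hε0, ?_⟩
  have h1 : HoldsWithHighProb μ fun n ω =>
      ‖(n : ℝ)⁻¹ • ∑ i ∈ Finset.range n, Λ (X i ω) - ∫ x, Λ x ∂M.P θT‖ < δ := by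
    simpa only [HoldsWithHighProb, not_lt] using
      strong_law_sample_measure hX hindep hlaw hΛm hΛ hδ0
  have h2 : HoldsWithHighProb μ fun n ω =>
      ‖(n : ℝ)⁻¹ • ∑ i ∈ Finset.range n, H (X i ω) - ∫ x, H x ∂M.P θT‖ < 1 := by
    simpa only [HoldsWithHighProb, not_lt] using
      strong_law_sample_measure hX hindep hlaw hHm hH one_pos
  have h3 := holdsWithHighProb_of_ae (ae_forall_sample hX hlaw hexp)
  refine ((h1.and h2).and h3).mono fun n ω ⟨⟨e1, e2⟩, e3⟩ u v hu hv => ?_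
  set Z := (n : ℝ)⁻¹ • ∑ i ∈ Finset.range n, ζ (X i ω) with hZ
  set L := (n : ℝ)⁻¹ • ∑ i ∈ Finset.range n, Λ (X i ω) with hL
  set h := (n : ℝ)⁻¹ • ∑ i ∈ Finset.range n, H (X i ω) with hh
  set w : EuclideanSpace ℝ (Fin d) × EuclideanSpace ℝ (Fin d) := (A.symm u, A.symm v) with hw
  have hwε : ‖w‖ ≤ a * ε := by
    rw [Prod.norm_def]
    exact max_le ((hA u).trans (by gcongr)) ((hA v).trans (by gcongr))
  have hwρ : ‖w‖ < ρ := by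
    calc ‖w‖ ≤ a * ε := hwε
      _ ≤ (a + 1) * (ρ / (a + 1) / 2) := by
          gcongr
          · linarith
          · exact min_le_left _ _
      _ = ρ / 2 := by field_simp
      _ < ρ := by linarith
  have hw2 : ‖w‖ ^ 2 ≤ a ^ 2 * (‖u‖ ^ 2 + ‖v‖ ^ 2) := by
    rw [Prod.norm_def]
    rcases max_choice ‖w.1‖ ‖w.2‖ with hm | hm <;> rw [hm]
    · calc ‖w.1‖ ^ 2 ≤ (a * ‖u‖) ^ 2 := pow_le_pow_left₀ (norm_nonneg _) (hA u) 2
        _ ≤ _ := by rw [mul_pow]; gcongr; linarith [sq_nonneg ‖v‖]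
    · calc ‖w.2‖ ^ 2 ≤ (a * ‖v‖) ^ 2 := pow_le_pow_left₀ (norm_nonneg _) (hA v) 2
        _ ≤ _ := by rw [mul_pow]; gcongr; linarith [sq_nonneg ‖u‖]
  have hemp : |M.empH φ X n ω (θT + A.symm u) (θT + A.symm v) - c * inner ℝ Z (v - u) -
      1 / 2 * L w w| ≤ h * ‖w‖ ^ 3 := by
    have e : M.empH φ X n ω (θT + A.symm u) (θT + A.symm v) - c * inner ℝ Z (v - u) -
        1 / 2 * L w w = (n : ℝ)⁻¹ * ∑ i ∈ Finset.range n,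
          (M.h φ (θT + A.symm u) (θT + A.symm v) (X i ω) - c * inner ℝ (ζ (X i ω)) (v - u) -
            1 / 2 * Λ (X i ω) w w) := by
      rw [Finset.sum_sub_distrib, Finset.sum_sub_distrib, ← Finset.mul_sum, ← Finset.mul_sum,
        ← sum_inner, empH, hZ, hL, real_inner_smul_left]
      simp only [smul_apply, FunLike.coe_sum, Finset.sum_apply, smul_eq_mul]
      ring
    rw [e, abs_mul, abs_of_nonneg (inv_nonneg.2 n.cast_nonneg), hh, smul_eq_mul, mul_assoc,
      Finset.sum_mul]
    gcongr
    refine (Finset.abs_sum_le_sum_abs _ _).trans (Finset.sum_le_sum fun i _ => ?_)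
    have := e3 i w hwρ
    simpa [hw] using this
  have hquad : |L w w - c * (‖u‖ ^ 2 - ‖v‖ ^ 2)| ≤ δ * ‖w‖ ^ 2 := by
    have e4 := hΛA w
    simp only [hw, A.apply_symm_apply] at e4
    rw [← e4]
    have e5 := (L - ∫ x, Λ x ∂M.P θT).le_opNorm₂ w w
    rw [sub_apply, sub_apply, Real.norm_eq_abs] at e5
    refine e5.trans ?_
    rw [mul_assoc, ← pow_two]
    gcongr
  have hh1 : h ≤ C := by
    have e6 := (abs_lt.1 e2).2
    have := le_abs_self (∫ x, H x ∂M.P θT)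
    linarith
  have hcube : h * ‖w‖ ^ 3 ≤ C * (a * ε) * ‖w‖ ^ 2 := by
    calc h * ‖w‖ ^ 3 ≤ C * ‖w‖ ^ 3 := by gcongr
      _ = C * ‖w‖ * ‖w‖ ^ 2 := by ring
      _ ≤ _ := by gcongr
  -- Completing the two squares; the terms ‖Z‖² cancel.
  have hid : inner ℝ Z (v - u) + (‖u‖ ^ 2 - ‖v‖ ^ 2) / 2 =
      ‖u - Z‖ ^ 2 / 2 - ‖v - Z‖ ^ 2 / 2 := by
    rw [norm_sub_sq_real, norm_sub_sq_real, inner_sub_right, real_inner_comm u Z,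
      real_inner_comm v Z]
    ring
  rw [← hid]
  have hδa : δ * a ^ 2 ≤ c * η := by
    calc δ * a ^ 2 = c * η * (a ^ 2 / (a ^ 2 + 1)) := by rw [hδ]; ring
      _ ≤ c * η * 1 := by
          gcongr
          exact (div_le_one (by positivity)).2 (by linarith)
      _ = _ := mul_one _
  have hCa : C * (a * ε) * a ^ 2 ≤ c * η / 2 := by
    calc C * (a * ε) * a ^ 2 = C * a ^ 3 * ε := by ring
      _ ≤ (C * a ^ 3 + 1) * (c * η / (C * a ^ 3 + 1) / 2) := by
          gcongr
          · linarith
          · exact min_le_right _ _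
      _ = _ := by field_simp
  have hfin : |M.empH φ X n ω (θT + A.symm u) (θT + A.symm v) -
      c * (inner ℝ Z (v - u) + (‖u‖ ^ 2 - ‖v‖ ^ 2) / 2)| ≤ c * (η * (‖u‖ ^ 2 + ‖v‖ ^ 2)) := by
    have hs : 0 ≤ ‖u‖ ^ 2 + ‖v‖ ^ 2 := by positivity
    have b1 := mul_le_mul_of_nonneg_left hw2 hδ0.le
    have b2 : C * (a * ε) * ‖w‖ ^ 2 ≤ C * (a * ε) * (a ^ 2 * (‖u‖ ^ 2 + ‖v‖ ^ 2)) := by gcongr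
    have b3 := mul_le_mul_of_nonneg_right hδa hs
    have b4 := mul_le_mul_of_nonneg_right hCa hs
    have b5 := abs_le.1 hemp
    have b6 := abs_le.1 hquad
    rw [abs_le]
    constructor <;> linarith
  have : M.empH φ X n ω (θT + A.symm u) (θT + A.symm v) / c -
      (inner ℝ Z (v - u) + (‖u‖ ^ 2 - ‖v‖ ^ 2) / 2) =
      (M.empH φ X n ω (θT + A.symm u) (θT + A.symm v) -
        c * (inner ℝ Z (v - u) + (‖u‖ ^ 2 - ‖v‖ ^ 2) / 2)) / c := by
    field_simp
  rw [this, abs_div, abs_of_pos hc, div_le_iff₀' hc]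
  exact hfin

end ParametricModel

/-! ### The test statistic on a fixed sample -/

namespace ParametricModel

section FixedSample

variable {d : ℕ} {𝒳 Ω : Type*} [MeasurableSpace 𝒳] {M : ParametricModel d 𝒳} {φ : ℝ → ℝ≥0∞}
  {X : ℕ → Ω → 𝒳}

theorem dualDiv_eq_of_isMaxOn {n : ℕ} {ω : Ω} {θ α : EuclideanSpace ℝ (Fin d)} (hα : α ∈ M.Θ)
    (h : IsMaxOn (M.empH φ X n ω θ) M.Θ α) :
    M.dualDiv φ X n ω θ = (M.empH φ X n ω θ α : EReal) :=
  le_antisymm (iSup₂_le fun _ hβ => EReal.coe_le_coe_iff.2 (h hβ))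
    (le_iSup₂ (f := fun β (_ : β ∈ M.Θ) => (M.empH φ X n ω θ β : EReal)) α hα)

theorem dualDivOn_eq_of_isMinOn {n : ℕ} {ω : Ω} {Θ₀ : Set (EuclideanSpace ℝ (Fin d))}
    {θ : EuclideanSpace ℝ (Fin d)} (hθ : θ ∈ Θ₀) (h : IsMinOn (M.dualDiv φ X n ω) Θ₀ θ) :
    M.dualDivOn φ X Θ₀ n ω = M.dualDiv φ X n ω θ :=
  le_antisymm (iInf₂_le θ hθ) (le_iInf₂ fun _ hβ => h hβ)


/-- The deterministic core. In whitened coordinates the supremum over α is attained and equals, up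
to the factor φ''(1), the profile D; the two quadratic estimates then apply to the inner
maximisation and to the outer minimisation. The factor 28 is 2 · 14. -/
theorem abs_testStat_sub_le {n : ℕ} {ω : Ω} (hc : 0 < phiDeriv2 φ 1)
    {Θ₀ U : Set (EuclideanSpace ℝ (Fin d))} {θT θ₁ : EuclideanSpace ℝ (Fin d)}
    {α₁ : EuclideanSpace ℝ (Fin d) → EuclideanSpace ℝ (Fin d)}
    {A : EuclideanSpace ℝ (Fin d) ≃L[ℝ] EuclideanSpace ℝ (Fin d)}
    {T : Submodule ℝ (EuclideanSpace ℝ (Fin d))} {Z : EuclideanSpace ℝ (Fin d)} {η ε : ℝ}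
    (hη0 : 0 ≤ η) (hη : η ≤ 1 / 16) (hZ : ‖Z‖ ≤ ε / 2)
    (hTK : ∀ τ ∈ T, ‖τ‖ ≤ ε → ∃ θ ∈ Θ₀, ‖A (θ - θT) - τ‖ ≤ η * ‖τ‖)
    (hKT : ∀ θ ∈ Θ₀, ‖A (θ - θT)‖ ≤ ε → ∃ τ ∈ T, ‖A (θ - θT) - τ‖ ≤ η * ‖A (θ - θT)‖)
    (hUΘ : ∀ u, ‖u‖ ≤ ε → θT + A.symm u ∈ U ∧ θT + A.symm u ∈ M.Θ)
    (hθ : θ₁ ∈ Θ₀ ∧ IsMinOn (M.dualDiv φ X n ω) Θ₀ θ₁) (hθε : ‖A (θ₁ - θT)‖ ≤ ε)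
    (hα : ∀ θ ∈ Θ₀ ∩ U, α₁ θ ∈ M.Θ ∧ IsMaxOn (M.empH φ X n ω θ) M.Θ (α₁ θ))
    (hαε : ∀ θ ∈ Θ₀ ∩ U, ‖A (α₁ θ - θT)‖ ≤ ε)
    (hexp : ∀ u v, ‖u‖ ≤ ε → ‖v‖ ≤ ε →
      |M.empH φ X n ω (θT + A.symm u) (θT + A.symm v) / phiDeriv2 φ 1 -
        (‖u - Z‖ ^ 2 / 2 - ‖v - Z‖ ^ 2 / 2)| ≤ η * (‖u‖ ^ 2 + ‖v‖ ^ 2)) :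
    |M.testStat φ X Θ₀ n ω - n * ‖Tᗮ.starProjection Z‖ ^ 2| ≤ 28 * η * (n * ‖Z‖ ^ 2) := by
  have hε : 0 ≤ ε := by linarith [norm_nonneg Z]
  have hback : ∀ θ, θT + A.symm (A (θ - θT)) = θ := fun θ => by simp
  set D : EuclideanSpace ℝ (Fin d) → ℝ := fun w =>
    M.empH φ X n ω (θT + A.symm w) (α₁ (θT + A.symm w)) / phiDeriv2 φ 1 with hD
  set K : Set (EuclideanSpace ℝ (Fin d)) := (fun θ => A (θ - θT)) '' Θ₀ with hK
  have hKU : ∀ w ∈ K, ‖w‖ ≤ ε → θT + A.symm w ∈ Θ₀ ∩ U := by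
    rintro _ ⟨θ, hθ, rfl⟩ hw
    refine ⟨?_, (hUΘ _ hw).1⟩
    simpa using hθ
  have hdual : ∀ w ∈ K, ‖w‖ ≤ ε → M.dualDiv φ X n ω (θT + A.symm w) =
      (M.empH φ X n ω (θT + A.symm w) (α₁ (θT + A.symm w)) : EReal) := fun w hw hwε =>
    have h := hα _ (hKU w hw hwε)
    dualDiv_eq_of_isMaxOn h.1 h.2
  have hu : A (θ₁ - θT) ∈ K := ⟨θ₁, hθ.1, rfl⟩
  have key := abs_min_sub_dist_le (K := K) T (D := D) (ζ := Z) (u := A (θ₁ - θT)) hη0 hη hZ ?_ ?_ ?_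
    hu hθε ?_
  · have hT : M.testStat φ X Θ₀ n ω = 2 * n * D (A (θ₁ - θT)) := by
      rw [testStat, dualDivOn_eq_of_isMinOn hθ.1 hθ.2]
      have := hdual _ hu hθε
      rw [hback] at this
      rw [this, EReal.toReal_coe, hD]
      simp only [hback]
      ring
    rw [hT]
    have e : 2 * n * D (A (θ₁ - θT)) - n * ‖Tᗮ.starProjection Z‖ ^ 2 =
        2 * n * (D (A (θ₁ - θT)) - ‖Tᗮ.starProjection Z‖ ^ 2 / 2) := by ring
    rw [e, abs_mul, abs_of_nonneg (by positivity)]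
    calc 2 * n * |D (A (θ₁ - θT)) - ‖Tᗮ.starProjection Z‖ ^ 2 / 2|
        ≤ 2 * n * (14 * η * ‖Z‖ ^ 2) := by gcongr
      _ = _ := by ring
  · intro τ hτ hτε
    obtain ⟨θ, hθ, h⟩ := hTK τ hτ hτε
    exact ⟨_, ⟨θ, hθ, rfl⟩, h⟩
  · rintro _ ⟨θ, hθ, rfl⟩ hw
    exact hKT θ hθ hw
  · intro w hw hwε
    have h := hα _ (hKU w hw hwε)
    -- The maximiser over all of Θ is compared with the point whose coordinate is Z, which lies in Θ
    -- because ‖Z‖ ≤ ε.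
    have h1 := abs_max_sub_quadratic_le
      (q := fun v => M.empH φ X n ω (θT + A.symm w) (θT + A.symm v) / phiDeriv2 φ 1)
      (u := w) (ζ := Z) (v := A (α₁ (θT + A.symm w) - θT)) (η := η) (ε := ε) (by linarith)
      (by linarith) (hαε _ (hKU w hw hwε)) (fun v hv => hexp w v hwε hv) ?_ hη0
    · simpa only [hback] using h1
    · simp only [hback]
      gcongr
      exact h.2 (hUΘ Z (by linarith)).2
  · intro w hw hwε
    have h1 := hθ.2 (hKU w hw hwε).1
    have h2 := hdual _ hu hθε
    rw [hback] at h2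
    simp only [Set.mem_ofPred_eq] at h1
    rw [h2, hdual w hw hwε, EReal.coe_le_coe_iff] at h1
    simp only [hD, hback]
    gcongr

end FixedSample

end ParametricModel

/-! ### The modified Kullback-Leibler divergence -/

theorem EReal.biSup_coe_eq_of_isLUB {ι : Type*} {B : Set ι} {f : ι → ℝ} {s : ℝ}
    (hB : B.Nonempty) (hs : IsLUB (f '' B) s) : ⨆ i ∈ B, (f i : EReal) = s := by
  refine le_antisymm (iSup₂_le fun i hi => EReal.coe_le_coe_iff.2 (hs.1 ⟨i, hi, rfl⟩)) ?_
  have hle : ∀ i ∈ B, (f i : EReal) ≤ ⨆ i ∈ B, (f i : EReal) := fun i hi =>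
    le_iSup₂ (f := fun i (_ : i ∈ B) => (f i : EReal)) i hi
  obtain ⟨i₀, hi₀⟩ := hB
  induction h : ⨆ i ∈ B, (f i : EReal) with
  | bot => exact absurd (h ▸ hle i₀ hi₀) (by simp)
  | top => exact le_top
  | coe y =>
    rw [EReal.coe_le_coe_iff]
    refine hs.2 ?_
    rintro _ ⟨i, hi, rfl⟩
    exact EReal.coe_le_coe_iff.1 (h ▸ hle i hi)

theorem EReal.biInf_coe_eq_of_isGLB {ι : Type*} {B : Set ι} {f : ι → ℝ} {s : ℝ}
    (hB : B.Nonempty) (hs : IsGLB (f '' B) s) : ⨅ i ∈ B, (f i : EReal) = s := by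
  refine le_antisymm ?_ (le_iInf₂ fun i hi => EReal.coe_le_coe_iff.2 (hs.1 ⟨i, hi, rfl⟩))
  have hle : ∀ i ∈ B, ⨅ i ∈ B, (f i : EReal) ≤ (f i : EReal) := fun i hi =>
    iInf₂_le (f := fun i (_ : i ∈ B) => (f i : EReal)) i hi
  obtain ⟨i₀, hi₀⟩ := hB
  induction h : ⨅ i ∈ B, (f i : EReal) with
  | bot => exact bot_le
  | top => exact absurd (h ▸ hle i₀ hi₀) (by simp)
  | coe y =>
    rw [EReal.coe_le_coe_iff]
    refine hs.2 ?_
    rintro _ ⟨i, hi, rfl⟩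
    exact EReal.coe_le_coe_iff.1 (h ▸ hle i hi)

theorem EReal.biSup_coe_eq_top {ι : Type*} {B : Set ι} {f : ι → ℝ}
    (hB : ¬ BddAbove (f '' B)) : ⨆ i ∈ B, (f i : EReal) = ⊤ := by
  by_contra hne
  refine hB ⟨(⨆ i ∈ B, (f i : EReal)).toReal, ?_⟩
  rintro _ ⟨i, hi, rfl⟩
  have hle : (f i : EReal) ≤ ⨆ i ∈ B, (f i : EReal) :=
    le_iSup₂ (f := fun i (_ : i ∈ B) => (f i : EReal)) i hi
  exact EReal.coe_le_coe_iff.1 (hle.trans (EReal.le_coe_toReal hne))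

/-- The minimax of differences of values of a function is the difference of its suprema. -/
theorem EReal.toReal_biInf_biSup_sub {ι : Type*} {B B₀ : Set ι} (hB : B₀ ⊆ B)
    (hB₀ : B₀.Nonempty) (L : ι → ℝ) {a : ℝ} (ha : 0 < a) :
    (⨅ θ ∈ B₀, ⨆ α ∈ B, ((a * (L α - L θ) : ℝ) : EReal)).toReal =
      a * ((⨆ α ∈ B, (L α : EReal)) - ⨆ θ ∈ B₀, (L θ : EReal)).toReal := by
  have hBn : B.Nonempty := hB₀.mono hB
  by_cases hb : BddAbove (L '' B)
  · have hs := isLUB_csSup (hBn.image L) hb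
    have hs₀ := isLUB_csSup (hB₀.image L) (hb.mono (Set.image_mono hB))
    set s := sSup (L '' B)
    set s₀ := sSup (L '' B₀)
    rw [EReal.biSup_coe_eq_of_isLUB hBn hs, EReal.biSup_coe_eq_of_isLUB hB₀ hs₀]
    have h1 : ∀ θ, ⨆ α ∈ B, ((a * (L α - L θ) : ℝ) : EReal) = ((a * (s - L θ) : ℝ) : EReal) := by
      refine fun θ => EReal.biSup_coe_eq_of_isLUB hBn ⟨?_, fun b hb => ?_⟩
      · rintro _ ⟨α, hα, rfl⟩
        have := hs.1 ⟨α, hα, rfl⟩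
        simp only
        gcongr
      · have : s ≤ b / a + L θ := by
          refine hs.2 ?_
          rintro _ ⟨α, hα, rfl⟩
          have h2 : a * (L α - L θ) ≤ b := hb ⟨α, hα, rfl⟩
          rw [← _root_.sub_le_iff_le_add, le_div_iff₀' ha]
          exact h2
        rwa [← _root_.sub_le_iff_le_add, le_div_iff₀' ha] at this
    simp_rw [h1]
    rw [EReal.biInf_coe_eq_of_isGLB (s := a * (s - s₀)) hB₀ ⟨?_, fun b hb => ?_⟩]
    · rw [← EReal.coe_sub, EReal.toReal_coe, EReal.toReal_coe]
    · rintro _ ⟨θ, hθ, rfl⟩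
      have := hs₀.1 ⟨θ, hθ, rfl⟩
      simp only
      gcongr
    · have : s₀ ≤ s - b / a := by
        refine hs₀.2 ?_
        rintro _ ⟨θ, hθ, rfl⟩
        have h2 : b ≤ a * (s - L θ) := hb ⟨θ, hθ, rfl⟩
        rw [le_sub_comm, div_le_iff₀' ha]
        exact h2
      rwa [le_sub_comm, div_le_iff₀' ha] at this
  -- With an infinite supremum over B the left side is `toReal ⊤ = 0`. On the right the difference
  -- is ⊤, or ⊤ - ⊤ = ⊥ when the supremum over B₀ is infinite too; `toReal` gives 0 in both cases.
  · have h1 : ∀ θ, ⨆ α ∈ B, ((a * (L α - L θ) : ℝ) : EReal) = ⊤ := by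
      refine fun θ => EReal.biSup_coe_eq_top fun ⟨b, hb'⟩ => hb ⟨b / a + L θ, ?_⟩
      rintro _ ⟨α, hα, rfl⟩
      have h2 : a * (L α - L θ) ≤ b := hb' ⟨α, hα, rfl⟩
      rw [← _root_.sub_le_iff_le_add, le_div_iff₀' ha]
      exact h2
    simp_rw [h1]
    rw [EReal.biSup_coe_eq_top hb]
    have h2 : ⨅ θ ∈ B₀, (⊤ : EReal) = ⊤ := by simp
    rw [h2]
    rcases eq_or_ne (⨆ θ ∈ B₀, (L θ : EReal)) ⊤ with h3 | h3
    · rw [h3]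
      simp
    · rw [EReal.top_sub h3]
      simp

theorem phiReal_phiKLm {u : ℝ} (hu : 0 < u) : phiReal phiKLm u = -Real.log u + u - 1 := by
  rw [phiReal, phiKLm, if_pos hu, ENNReal.toReal_ofReal]
  linarith [Real.log_le_sub_one_of_pos hu]

theorem phiDeriv_phiKLm {u : ℝ} (hu : 0 < u) : phiDeriv phiKLm u = 1 - u⁻¹ := by
  have h1 : HasDerivAt (fun u : ℝ => -Real.log u + u - 1) (-u⁻¹ + 1) u :=
    ((Real.hasDerivAt_log hu.ne').neg.add (hasDerivAt_id u)).sub_const 1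
  have h2 : phiReal phiKLm =ᶠ[𝓝 u] fun u => -Real.log u + u - 1 := by
    filter_upwards [eventually_gt_nhds hu] with v hv using phiReal_phiKLm hv
  rw [phiDeriv, (h1.congr_of_eventuallyEq h2).deriv]
  ring

theorem phiDeriv2_phiKLm_one : phiDeriv2 phiKLm 1 = 1 := by
  have h1 : HasDerivAt (fun u : ℝ => 1 - u⁻¹) (-(-((1 : ℝ) ^ 2)⁻¹)) 1 :=
    (hasDerivAt_inv one_ne_zero).const_sub 1
  have h2 : phiDeriv phiKLm =ᶠ[𝓝 1] fun u => 1 - u⁻¹ := by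
    filter_upwards [eventually_gt_nhds one_pos] with v hv using phiDeriv_phiKLm hv
  rw [phiDeriv2, (h1.congr_of_eventuallyEq h2).deriv]
  norm_num

namespace ParametricModel

variable {d : ℕ} {𝒳 Ω : Type*} [MeasurableSpace 𝒳] {M : ParametricModel d 𝒳}
  {θT : EuclideanSpace ℝ (Fin d)}

/-- Since φ'(u) = 1 - 1/u, the integrand p_θ φ'(p_θ/p_α) is p_θ - p_α; the common support makes this
true also where p_θ vanishes. -/
theorem integral_f_phiKLm {θ α : EuclideanSpace ℝ (Fin d)} (hθ : θ ∈ M.Θ) (hα : α ∈ M.Θ) :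
    ∫ x, M.f phiKLm θ α x ∂M.P θ = 0 := by
  rw [integral_P hθ]
  have : ∀ᵐ x ∂M.ref, M.p θ x • M.f phiKLm θ α x = M.p θ x - M.p α x := by
    filter_upwards [M.common_support] with x hx
    rcases (M.p_nonneg θ hθ x).eq_or_lt' with h | h
    · have h' : M.p α x = 0 := by
        refine ((M.p_nonneg α hα x).eq_or_lt').resolve_right fun h3 => ?_
        exact ((hx α hα θ hθ).1 h3).ne' h
      simp [h, h']
    · have h' := (hx θ hθ α hα).1 h
      rw [f, phiDeriv_phiKLm (div_pos h h'), smul_eq_mul]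
      field_simp
  rw [integral_congr_ae this, integral_sub (integrable_p hθ) (integrable_p hα), integral_p hθ,
    integral_p hα, sub_self]

theorem h_phiKLm {θ α : EuclideanSpace ℝ (Fin d)} (hθ : θ ∈ M.Θ) (hα : α ∈ M.Θ) {x : 𝒳}
    (h1 : 0 < M.p θ x) (h2 : 0 < M.p α x) :
    M.h phiKLm θ α x = Real.log (M.p α x) - Real.log (M.p θ x) := by
  have h3 := div_pos h1 h2
  rw [h, integral_f_phiKLm hθ hα, g, phiDeriv_phiKLm h3, phiReal_phiKLm h3,
    Real.log_div h1.ne' h2.ne']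
  field_simp
  ring

/-- For the modified Kullback-Leibler divergence the test statistic is the generalized likelihood
ratio statistic. -/
theorem testStat_phiKLm {X : ℕ → Ω → 𝒳} {Θ₀ : Set (EuclideanSpace ℝ (Fin d))} (hΘ₀ : Θ₀ ⊆ M.Θ)
    (hne : Θ₀.Nonempty) {ω : Ω} (hω : ∀ i, ∀ θ ∈ M.Θ, 0 < M.p θ (X i ω)) (n : ℕ) :
    M.testStat phiKLm X Θ₀ n ω = M.genLikRatioStat X Θ₀ n ω := by
  rcases n.eq_zero_or_pos with rfl | hn
  · have h1 : M.Θ.Nonempty := hne.mono hΘ₀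
    simp only [testStat, genLikRatioStat, logLik, Finset.range_zero, Finset.sum_empty,
      EReal.coe_zero]
    rw [biSup_const h1, biSup_const hne]
    simp
  · have hn' : (0 : ℝ) < n := Nat.cast_pos.2 hn
    have h1 : M.dualDivOn phiKLm X Θ₀ n ω = ⨅ θ ∈ Θ₀, ⨆ α ∈ M.Θ,
        (((n : ℝ)⁻¹ * (M.logLik X n ω α - M.logLik X n ω θ) : ℝ) : EReal) := by
      refine biInf_congr fun θ hθ => biSup_congr fun α hα => ?_
      rw [empH, logLik, logLik, ← Finset.sum_sub_distrib]
      congr 2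
      exact Finset.sum_congr rfl fun i _ =>
        h_phiKLm (hΘ₀ hθ) hα (hω i θ (hΘ₀ hθ)) (hω i α hα)
    rw [testStat, h1, EReal.toReal_biInf_biSup_sub hΘ₀ hne _ (inv_pos.2 hn'),
      phiDeriv2_phiKLm_one, genLikRatioStat]
    field_simp

theorem ae_forall_p_pos (hθ : θT ∈ M.Θ) : ∀ᵐ x ∂M.P θT, ∀ θ ∈ M.Θ, 0 < M.p θ x := by
  rw [ae_P_iff hθ]
  filter_upwards [M.common_support] with x hx h0 θ hθ'
  exact (hx θT hθ θ hθ').1 h0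

end ParametricModel

/-! ### Convergence to the chi-square law -/

theorem map_norm_sq_stdGaussian (l : ℕ) :
    (stdGaussian (EuclideanSpace ℝ (Fin l))).map (fun z => ‖z‖ ^ 2) = chiSquare l := by
  rw [← map_pi_eq_stdGaussian, Measure.map_map (by fun_prop) (by fun_prop), chiSquare]
  congr 1
  ext z
  simp [EuclideanSpace.real_norm_sq_eq]

section Projection

variable {E 𝒳 Ω : Type*} [NormedAddCommGroup E] [InnerProductSpace ℝ E] [FiniteDimensional ℝ E]
  [MeasurableSpace E] [BorelSpace E] [MeasurableSpace 𝒳] [MeasurableSpace Ω] {P : Measure 𝒳}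
  {μ : Measure Ω} [IsProbabilityMeasure μ] {X : ℕ → Ω → 𝒳}

/-- The squared norm of the projection of a normalised sum on a subspace of dimension `l` is
asymptotically chi-square with `l` degrees of freedom. -/
theorem tendstoInDistribution_chiSquare (hX : ∀ i, Measurable (X i)) (hindep : iIndepFun X μ)
    (hlaw : ∀ i, μ.map (X i) = P) {Y : 𝒳 → E} (hY : Measurable Y)
    (h0 : ∀ w, ∫ x, inner ℝ (Y x) w ∂P = 0) (h1 : ∀ w, ∫ x, inner ℝ (Y x) w ^ 2 ∂P = ‖w‖ ^ 2)
    (S : Submodule ℝ E) {l : ℕ} (hS : Module.finrank ℝ S = l) :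
    TendstoInDistribution (fun (n : ℕ) ω =>
      n * ‖S.starProjection ((n : ℝ)⁻¹ • ∑ i ∈ Finset.range n, Y (X i ω))‖ ^ 2) atTop id
      (fun _ => μ) (chiSquare l) := by
  set b : OrthonormalBasis (Fin l) ℝ S := (stdOrthonormalBasis ℝ S).reindex (finCongr hS)
  set Q : E →L[ℝ] EuclideanSpace ℝ (Fin l) :=
    (b.repr.toContinuousLinearEquiv : S →L[ℝ] EuclideanSpace ℝ (Fin l)).comp
      S.orthogonalProjectionOnto with hQ
  have hQn : ∀ v, ‖Q v‖ = ‖S.starProjection v‖ := fun v => by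
    rw [Submodule.starProjection_apply, ← Submodule.coe_norm]
    exact b.repr.norm_map _
  have hQi : ∀ v w, inner ℝ (Q v) w = inner ℝ v (b.repr.symm w : E) := fun v w => by
    have e : inner ℝ (Q v) w = inner ℝ (S.orthogonalProjectionOnto v) (b.repr.symm w) := by
      rw [← b.repr.inner_map_map, b.repr.apply_symm_apply]
      rfl
    rw [e, Submodule.coe_inner, ← Submodule.starProjection_apply,
      Submodule.inner_starProjection_left_eq_right]
    congr 1
    exact Submodule.starProjection_eq_self_iff.2 (b.repr.symm w).2
  -- Coordinates of the projection in an orthonormal basis of S again have mean zero and identity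
  -- covariance, so the central limit theorem applies directly in ℝ^l.
  have hC := tendstoInDistribution_stdGaussian hX hindep hlaw (Y := fun x => Q (Y x))
    (by fun_prop) (fun w => by simp_rw [hQi]; exact h0 _)
    (fun w => by simp_rw [hQi]; rw [h1, ← Submodule.coe_norm, b.repr.symm.norm_map])
  have hC2 := hC.continuous_comp (g := fun z => ‖z‖ ^ 2) (by fun_prop)
  have he : ∀ (n : ℕ) ω, ‖(√n)⁻¹ • ∑ i ∈ Finset.range n, Q (Y (X i ω))‖ ^ 2 =
      n * ‖S.starProjection ((n : ℝ)⁻¹ • ∑ i ∈ Finset.range n, Y (X i ω))‖ ^ 2 := fun n ω => by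
    rw [← map_sum, norm_smul, hQn, map_smul, norm_smul, mul_pow, mul_pow]
    rcases n.eq_zero_or_pos with rfl | hn
    · simp
    · have hn' : (0 : ℝ) < n := Nat.cast_pos.2 hn
      rw [norm_inv, norm_inv, inv_pow, Real.norm_of_nonneg (Real.sqrt_nonneg _),
        Real.sq_sqrt hn'.le, Real.norm_of_nonneg hn'.le]
      field_simp
  have hfun : (fun (n : ℕ) ω =>
      (n : ℝ) * ‖S.starProjection ((n : ℝ)⁻¹ • ∑ i ∈ Finset.range n, Y (X i ω))‖ ^ 2) =
      fun (n : ℕ) => (fun z : EuclideanSpace ℝ (Fin l) => ‖z‖ ^ 2) ∘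
        fun ω => (√n)⁻¹ • ∑ i ∈ Finset.range n, Q (Y (X i ω)) := by
    funext n ω
    exact (he n ω).symm
  rw [hfun]
  refine ⟨hC2.forall_aemeasurable, aemeasurable_id, ?_⟩
  refine hC2.tendsto.trans (le_of_eq (congrArg 𝓝 (Subtype.ext ?_)))
  change (stdGaussian _).map ((fun z : EuclideanSpace ℝ (Fin l) => ‖z‖ ^ 2) ∘ id) =
    (chiSquare l).map id
  rw [Measure.map_id, Function.comp_id, map_norm_sq_stdGaussian]

end Projection

end

/-! ### The limit law and the likelihood ratio identity -/

theorem mainTheorem2 {d l : ℕ} {𝒳 Ω : Type*} [MeasurableSpace 𝒳] [MeasurableSpace Ω]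
    -- the divergence
    (φ : ℝ → ℝ≥0∞) (hφ : IsDivergenceFunction φ)
    (hφ4 : ContDiffOn ℝ 4 (phiReal φ) (interior (phiDom φ))) (hφ2 : 0 < phiDeriv2 φ 1)
    -- the model
    (M : ParametricModel d 𝒳) (hint : M.IntegrabilityCondition φ)
    -- the true parameter, an interior point of the parameter space, and regularity around it
    (θT : EuclideanSpace ℝ (Fin d)) (N : Set (EuclideanSpace ℝ (Fin d)))
    (hN : IsOpen N) (hθN : θT ∈ N) (hNΘ : N ⊆ M.Θ)
    (hp : ∀ᵐ x ∂M.ref, ContDiffOn ℝ 3 (fun θ => M.p θ x) N)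
    (hdom : M.DominationCondition φ θT N) (hmom : M.MomentCondition φ θT)
    -- the null hypothesis
    (Θ₀ : Set (EuclideanSpace ℝ (Fin d))) (B₀ : Set (EuclideanSpace ℝ (Fin (d - l))))
    (s : EuclideanSpace ℝ (Fin (d - l)) → EuclideanSpace ℝ (Fin d))
    (r : EuclideanSpace ℝ (Fin d) → EuclideanSpace ℝ (Fin l))
    (hΘ₀ : IsSmoothHypothesis M.Θ Θ₀ B₀ s r) (hH0 : θT ∈ Θ₀)
    -- the sample
    (μ : Measure Ω) [IsProbabilityMeasure μ] (X : ℕ → Ω → 𝒳) (hX : ∀ i, Measurable (X i))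
    (hindep : iIndepFun X μ) (hlaw : ∀ i, μ.map (X i) = M.P θT)
    -- the estimators
    (θhat : ℕ → Ω → EuclideanSpace ℝ (Fin d))
    (αhat : ℕ → Ω → EuclideanSpace ℝ (Fin d) → EuclideanSpace ℝ (Fin d))
    (U : Set (EuclideanSpace ℝ (Fin d))) (hU : U ∈ 𝓝 θT)
    (hest : M.ConsistentEstimators φ X μ θT Θ₀ θhat αhat U)
    -- the statistic is a random variable
    (hmeas : ∀ n, AEMeasurable (M.testStat φ X Θ₀ n) μ) :
    TendstoInDistribution (M.testStat φ X Θ₀) atTop id (fun _ => μ) (chiSquare l) ∧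
      (φ = phiKLm → ∀ n, ∀ᵐ ω ∂μ, M.testStat φ X Θ₀ n ω = M.genLikRatioStat X Θ₀ n ω) := by
  have hθΘ : θT ∈ M.Θ := hNΘ hθN
  refine ⟨?_, ?_⟩
  swap
  · rintro rfl n
    filter_upwards [ae_forall_sample hX hlaw (ParametricModel.ae_forall_p_pos hθΘ)] with ω hω
    exact ParametricModel.testStat_phiKLm hΘ₀.subset ⟨θT, hH0⟩ hω n
  obtain ⟨A, ζ, Λ, H, ρ, hρ, hρN, hζ, hζ0, hζ1, hΛm, hΛ, hΛA, hHm, hH, hexp⟩ :=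
    ParametricModel.exists_local_expansion hφ hφ4 hφ2 hint hN hθN hNΘ hp hdom hmom
  have hΘint : θT ∈ interior M.Θ := interior_maximal hNΘ hN hθN
  obtain ⟨T, hT, htan⟩ := hΘ₀.exists_tangent hH0 hΘint A
  have hTl : Module.finrank ℝ Tᗮ = l := by
    have h1 := T.finrank_add_finrank_orthogonal
    rw [hT, finrank_euclideanSpace_fin] at h1
    have := hΘ₀.le
    omega
  -- Slutsky: it remains to see that the statistic and the squared projection differ by a quantity
  -- tending to zero in probability.
  refine tendstoInDistribution_of_tendstoInMeasure_sub _ _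
    (tendstoInDistribution_chiSquare hX hindep hlaw hζ hζ0 hζ1 Tᗮ hTl) ?_ hmeas
  rw [tendstoInMeasure_iff_norm]
  intro κ hκ
  suffices h : HoldsWithHighProb μ fun n ω => |M.testStat φ X Θ₀ n ω -
      n * ‖Tᗮ.starProjection ((n : ℝ)⁻¹ • ∑ i ∈ Finset.range n, ζ (X i ω))‖ ^ 2| < κ by
    simpa only [HoldsWithHighProb, not_lt, Pi.sub_apply, Pi.zero_apply, sub_zero,
      Real.norm_eq_abs] using h
  refine holdsWithHighProb_of_forall_le fun δ hδ => ?_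
  obtain ⟨R, hR, hRδ⟩ := exists_measure_norm_le_of_tendstoInDistribution
    (tendstoInDistribution_stdGaussian hX hindep hlaw hζ hζ0 hζ1) hδ
  -- R bounds √n‖Z‖ outside an event of probability δ; the second term makes the final error 28ηR²
  -- at most κ/2.
  set η : ℝ := min (1 / 16) (κ / (28 * R ^ 2) / 2) with hη
  have hη0 : 0 < η := by positivity
  obtain ⟨ε₁, hε₁, h1⟩ := ParametricModel.exists_empH_expansion hφ2 hX hindep hlaw hρ hΛm hΛ hΛA
    hHm hH hexp hη0
  obtain ⟨ε₂, hε₂, hTK, hKT⟩ := htan η hη0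
  have hc : Tendsto (fun u => θT + A.symm u) (𝓝 0) (𝓝 θT) := by
    have h : Continuous fun u => θT + A.symm u := by fun_prop
    simpa using h.tendsto 0
  have hUN : ∀ᶠ u in 𝓝 (0 : EuclideanSpace ℝ (Fin d)),
      θT + A.symm u ∈ U ∧ θT + A.symm u ∈ M.Θ := by
    refine (hc.eventually hU).and
      ((hc.eventually (hN.mem_nhds hθN)).mono fun u hu => hNΘ hu)
  obtain ⟨ε₃, hε₃, hUΘ⟩ := Metric.eventually_nhds_iff.1 hUN
  set ε : ℝ := min (min ε₁ ε₂) (ε₃ / 2) with hε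
  have hε0 : 0 < ε := by positivity
  have hεε₁ : ε ≤ ε₁ := (min_le_left _ _).trans (min_le_left _ _)
  have hεε₂ : ε ≤ ε₂ := (min_le_left _ _).trans (min_le_right _ _)
  have hεε₃ : ε < ε₃ := (min_le_right _ _).trans_lt (half_lt_self hε₃)
  set a := ‖(A : EuclideanSpace ℝ (Fin d) →L[ℝ] EuclideanSpace ℝ (Fin d))‖ with ha
  have ha0 : 0 ≤ a := norm_nonneg _
  have hA : ∀ v, ‖v‖ < ε / (a + 1) → ‖A v‖ ≤ ε := fun v hv => by
    have h3 : ‖A v‖ ≤ a * ‖v‖ :=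
      (A : EuclideanSpace ℝ (Fin d) →L[ℝ] EuclideanSpace ℝ (Fin d)).le_opNorm v
    calc ‖A v‖ ≤ (a + 1) * (ε / (a + 1)) := h3.trans (by gcongr; linarith)
      _ = ε := by field_simp
  have hεa : 0 < ε / (a + 1) := by positivity
  have h2 : HoldsWithHighProb μ fun n ω =>
      θhat n ω ∈ Θ₀ ∧ IsMinOn (M.dualDiv φ X n ω) Θ₀ (θhat n ω) := hest.exists_θ
  have h3 : HoldsWithHighProb μ fun n ω => ‖θhat n ω - θT‖ < ε / (a + 1) := by
    simpa only [HoldsWithHighProb, not_lt] using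
      tendstoInMeasure_iff_norm.1 hest.consistent_θ _ hεa
  have h4 : HoldsWithHighProb μ fun n ω => ∀ θ ∈ Θ₀ ∩ U, αhat n ω θ ∈ M.Θ ∧
      IsMaxOn (M.empH φ X n ω θ) M.Θ (αhat n ω θ) := hest.exists_α
  have h5 : HoldsWithHighProb μ fun n ω => ∀ θ ∈ Θ₀ ∩ U, ‖αhat n ω θ - θT‖ < ε / (a + 1) := by
    have := hest.consistent_α _ hεa
    simpa only [HoldsWithHighProb, not_forall, not_lt, exists_prop] using this
  -- Once √n ε/2 ≥ R, the bound √n‖Z‖ < R forces ‖Z‖ ≤ ε/2, so Z lies in the range of the local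
  -- expansion.
  have h6 : HoldsWithHighProb μ fun n (_ : Ω) => 0 < n ∧ R ≤ √n * (ε / 2) := by
    refine holdsWithHighProb_of_eventually ?_
    have : Tendsto (fun n : ℕ => √n * (ε / 2)) atTop atTop :=
      (Real.tendsto_sqrt_atTop.comp tendsto_natCast_atTop_atTop).atTop_mul_const (by positivity)
    filter_upwards [eventually_gt_atTop 0, this.eventually_ge_atTop R] with n hn hn' _
      using ⟨hn, hn'⟩
  refine ⟨_, ((((h1.and h2).and h3).and h4).and h5).and h6, fun n ω =>
    ‖(√n)⁻¹ • ∑ i ∈ Finset.range n, ζ (X i ω)‖ < R, hRδ, ?_⟩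
  rintro n ω ⟨⟨⟨⟨⟨e1, e2⟩, e3⟩, e4⟩, e5⟩, hn, hRn⟩ e7
  set Z := (n : ℝ)⁻¹ • ∑ i ∈ Finset.range n, ζ (X i ω) with hZ
  have hn' : (0 : ℝ) < n := Nat.cast_pos.2 hn
  have hsn : 0 < √(n : ℝ) := Real.sqrt_pos.2 hn'
  have hZn : √n * ‖Z‖ = ‖(√n)⁻¹ • ∑ i ∈ Finset.range n, ζ (X i ω)‖ := by
    rw [hZ, norm_smul, norm_smul, norm_inv, norm_inv, Real.norm_of_nonneg hsn.le,
      Real.norm_of_nonneg hn'.le]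
    nth_rewrite 2 [← Real.mul_self_sqrt hn'.le]
    field_simp
  rw [← hZn] at e7
  have hZε : ‖Z‖ ≤ ε / 2 := le_of_mul_le_mul_left (e7.le.trans hRn) hsn
  have hZR : n * ‖Z‖ ^ 2 ≤ R ^ 2 := by
    have := pow_le_pow_left₀ (by positivity) e7.le 2
    rwa [mul_pow, Real.sq_sqrt hn'.le] at this
  have hfin := ParametricModel.abs_testStat_sub_le hφ2 hη0.le (min_le_left _ _) hZε
    (fun τ hτ h => hTK τ hτ (h.trans hεε₂)) (fun θ hθ h => hKT θ hθ (h.trans hεε₂))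
    (fun u hu => hUΘ (by simpa using hu.trans_lt hεε₃)) e2 (hA _ e3) e4
    (fun θ hθ => hA _ (e5 θ hθ)) (fun u v hu hv => e1 u v (hu.trans hεε₁) (hv.trans hεε₁))
  calc _ ≤ 28 * η * (n * ‖Z‖ ^ 2) := hfin
    _ ≤ 28 * (κ / (28 * R ^ 2) / 2) * R ^ 2 := by
        gcongr
        exact min_le_right _ _
    _ = κ / 2 := by field_simp
    _ < κ := half_lt_self hκ
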